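/- Work in the complex projective plane $\mathbb P^2$ with homogeneous coordinates $[x:y:z]$. Let $\ell_\infty=V(z)$, $I=[1:i:0]$, $J=[1:-i:0]$. Let $F\in\mathbb C[x,y,z]$ be an irreducible homogeneous polynomial of degree $d$, let $\mathcal C=V(F)\subset\mathbb P^2$ (the mirror), and let $S=[x_0:y_0:z_0]\in\mathbb P^2$ (the source). For $m=[x:y:z]\in\mathcal C\setminus(\{S\}\cup\ell_\infty\cup V(F_x^2+F_y^2))$ the reflected line $\mathcal R_m$ is the line joining $m$ to the point $r\in\ell_\infty$ determined by $\beta(s,t,I,J)=\beta(t,r,I,J)$, where $\beta$ is the cross-ratio, $t=[F_y:-F_x:0]$ is the point at infinity of the tangent line to $\mathcal C$ at $m$, and $s$ is the point at infinity of the line $(mS)$. Equivalently, $\mathcal R_m$ is the line $u_mX+v_mY+w_mZ=0$ with, writing $\Delta_SF=x_0F_x+y_0F_y+z_0F_z$, $$u_m=(z_0y-zy_0)(F_x^2+F_y^2)+2z\,\Delta_SF\,F_y,\qquad v_m=(zx_0-z_0x)(F_x^2+F_y^2)-2z\,\Delta_SF\,F_x,$$ $$w_m=(xy_0-yx_0)(F_x^2+F_y^2)-2\,\Delta_SF\,(xF_y-yF_x).$$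 A point $P=[X:Y:Z]$ is characteristic at $m$ if $u_mX+v_mY+w_mZ=0$ and the derivative of $m\mapsto u_mX+v_mY+w_mZ$ at $m$ vanishes in every direction $\tau\in\mathbb C^3$ with $dF(m)\tau=0$. The envelope of the reflected lines is the set of all points $P$ such that, for some $m$ as above, $P$ is the unique characteristic point at $m$. The caustic by reflection $\Sigma_S(\mathcal C)$ is the Zariski closure of this envelope in $\mathbb P^2$. When $d=2$, $S$ is called a focus of the conic $\mathcal C$ if either $S\notin\ell_\infty$ and both isotropic lines $(IS)$ and $(JS)$ are tangent to $\mathcal C$ (possibly at $I$ or $J$), or $S\in\mathcal C$ and $\mathcal C$ is tangent to $\ell_\infty$ at $S$. **Proposition.** Assume that (i) $S\notin\{I,J\}$; (ii) $\mathcal C$ is not a line, i.e. $d\neq1$; (iii) if $d=2$, then $S$ is not a focus of the conic $\mathcal C$. Then $\Sigma_S(\mathcal C)$ is not reduced to a point, and it is an irreducible algebraic curve, i.e. $\Sigma_S(\mathcal C)=V(G)$ for some irreducible homogeneous polynomial $G$. -/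

import Mathlib

open scoped LinearAlgebra.Projectivization

noncomputable section

namespace CausticByReflection

/-- Homogeneous coordinate vectors. -/
abbrev Vec : Type := Fin 3 → ℂ

/-- The complex projective plane. -/
abbrev P2 : Type := ℙ ℂ Vec

/-- Polynomials in the homogeneous coordinates `x = X 0`, `y = X 1`, `z = X 2`. -/
abbrev Poly : Type := MvPolynomial (Fin 3) ℂ

open MvPolynomial Matrix

/-! ### Projective plane curves -/

/-- The zero locus `V(G)` of `G` in the projective plane
(only used for homogeneous `G`, where it does not depend on representatives). -/
def zeroLocus (G : Poly) : Set P2 := {P | eval P.rep G = 0}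

/-- Zariski closure in the projective plane: the common zeros of all homogeneous polynomials
that vanish on `A`. -/
def zariskiClosure (A : Set P2) : Set P2 :=
  {P | ∀ (G : Poly) (n : ℕ), G.IsHomogeneous n → A ⊆ zeroLocus G → P ∈ zeroLocus G}

/-- `A` is an irreducible algebraic curve of the projective plane:
`A = V(G)` for some irreducible homogeneous polynomial `G` (automatically of positive degree). -/
def IsIrreducibleCurve (A : Set P2) : Prop :=
  ∃ (G : Poly) (n : ℕ), G.IsHomogeneous n ∧ Irreducible G ∧ A = zeroLocus G

/-- The cyclic point `I = [1 : i : 0]`. -/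
def cyclicI : P2 :=
  Projectivization.mk ℂ ![1, Complex.I, 0] (fun h => one_ne_zero (congrFun h 0))

/-- The cyclic point `J = [1 : -i : 0]`. -/
def cyclicJ : P2 :=
  Projectivization.mk ℂ ![1, -Complex.I, 0] (fun h => one_ne_zero (congrFun h 0))

/-- The line at infinity `V(z)`. -/
def lineAtInfinity : Set P2 := zeroLocus (X 2)

/-- The gradient `(F_x, F_y, F_z)` at the vector `a`. -/
def gradAt (F : Poly) (a : Vec) : Vec := fun i => eval a (pderiv i F)

/-- The point `m` of `V(F)` is nonsingular: the gradient does not vanish there. -/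
def IsNonsingularAt (F : Poly) (m : P2) : Prop := gradAt F m.rep ≠ 0

/-- The tangent line to `V(F)` at a nonsingular point `m`. -/
def tangentLine (F : Poly) (m : P2) : Set P2 := {P | gradAt F m.rep ⬝ᵥ P.rep = 0}

/-- The (unique) line through two distinct points `A`, `B` is tangent to `V(F)`
at some nonsingular point. -/
def IsTangentLineThrough (F : Poly) (A B : P2) : Prop :=
  ∃ m ∈ zeroLocus F, IsNonsingularAt F m ∧ A ∈ tangentLine F m ∧ B ∈ tangentLine F m

/-- `S` is a focus of the conic `V(F)`. A point `S` at finite distance is a focus when its two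
isotropic lines `(IS)` and `(JS)` are tangent to the conic (tangency at `I` or `J` being allowed,
so that the centre of a circle is a focus). A point `S` at infinity is a focus
when the conic is tangent to the line at infinity at `S`
(the focus at infinity of a parabola, that is, the point at infinity of its axis). -/
def IsFocus (F : Poly) (S : P2) : Prop :=
  (S ∉ lineAtInfinity ∧ IsTangentLineThrough F cyclicI S ∧ IsTangentLineThrough F cyclicJ S) ∨
  (S ∈ zeroLocus F ∧ IsNonsingularAt F S ∧ tangentLine F S = lineAtInfinity)

/-! ### Reflected lines -/

/-- `Q(∇F) = F_x ^ 2 + F_y ^ 2`. -/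
def gradSq (F : Poly) : Poly := pderiv 0 F ^ 2 + pderiv 1 F ^ 2

/-- The polar `Δ_s F = x₀ F_x + y₀ F_y + z₀ F_z`. -/
def polar (s : Vec) (F : Poly) : Poly :=
  C (s 0) * pderiv 0 F + C (s 1) * pderiv 1 F + C (s 2) * pderiv 2 F

/-- The points of `V(F)` at which the reflected line of the ray coming from `S` is defined:
`V(F) \ ({S} ∪ ℓ_∞ ∪ V(Q(∇F)))`. -/
def mirrorDomain (F : Poly) (S : P2) : Set P2 :=
  zeroLocus F \ ({S} ∪ lineAtInfinity ∪ zeroLocus (gradSq F))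

/-- The Snell–Descartes law for directions (points `[a : b : 0]` of the line at infinity, written
as pairs): `β(p, t, I, J) = β(t, q, I, J)`, where
`β(p, t, I, J) = (p₀ + i p₁) (t₀ - i t₁) / ((p₀ - i p₁) (t₀ + i t₁))`, with the denominators
cleared. Here `t` is the tangent direction, `p` the incident and `q` the reflected one. -/
def IsReflectedDirection (t p q : Fin 2 → ℂ) : Prop :=
  ((p 0 + Complex.I * p 1) * (t 0 - Complex.I * t 1)) *
      ((q 0 + Complex.I * q 1) * (t 0 - Complex.I * t 1)) =
    ((p 0 - Complex.I * p 1) * (t 0 + Complex.I * t 1)) *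
      ((q 0 - Complex.I * q 1) * (t 0 + Complex.I * t 1))

/-- The reflected line at `m`: the points `P` of the line joining `m` to the point at infinity
`[q₀ : q₁ : 0]` that is the reflection of the point at infinity
`[x₀ z - z₀ x : y₀ z - z₀ y : 0]` of the line `(m S)` in the tangent direction `[F_y : - F_x : 0]`.
-/
def reflectedLine (F : Poly) (S m : P2) : Set P2 :=
  {P | ∃ q : Fin 2 → ℂ, q ≠ 0 ∧
    IsReflectedDirection ![gradAt F m.rep 1, - gradAt F m.rep 0]
      ![S.rep 0 * m.rep 2 - S.rep 2 * m.rep 0, S.rep 1 * m.rep 2 - S.rep 2 * m.rep 1] q ∧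
    P.rep ⬝ᵥ (m.rep ⨯₃ ![q 0, q 1, 0]) = 0}

/-- The polynomial vector `(u, v, w)` defining the reflected map `m ↦ [u : v : w]` of `V(F)` from
the source with coordinates `s = (x₀, y₀, z₀)`; the reflected line at `m` is
`u X + v Y + w Z = 0`, see `mem_reflectedLine_iff`. -/
def reflectedMap (F : Poly) (s : Vec) : Fin 3 → Poly :=
  ![(C (s 2) * X 1 - X 2 * C (s 1)) * gradSq F + 2 * X 2 * polar s F * pderiv 1 F,
    (X 2 * C (s 0) - C (s 2) * X 0) * gradSq F - 2 * X 2 * polar s F * pderiv 0 F,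
    (X 0 * C (s 1) - X 1 * C (s 0)) * gradSq F
      - 2 * polar s F * (X 0 * pderiv 1 F - X 1 * pderiv 0 F)]

/-- Coefficients of the reflected line at the point with coordinates `a`. -/
def reflectedAt (F : Poly) (s a : Vec) : Vec := fun i => eval a (reflectedMap F s i)

/-- Derivative at `a`, in the direction `τ`, of the coefficients of the reflected line. -/
def reflectedDerivAt (F : Poly) (s a τ : Vec) : Vec :=
  fun i => ∑ j, τ j * eval a (pderiv j (reflectedMap F s i))

/-! ### The caustic -/

/-- `P` is a characteristic point, at the parameter `m`, of the one-parameter family of reflected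
lines: `P` satisfies the equation of the reflected line at `m` and the equation obtained by
differentiating it along the mirror curve. -/
def IsCharacteristicPoint (F : Poly) (S m P : P2) : Prop :=
  reflectedAt F S.rep m.rep ⬝ᵥ P.rep = 0 ∧
  ∀ τ : Vec, gradAt F m.rep ⬝ᵥ τ = 0 → reflectedDerivAt F S.rep m.rep τ ⬝ᵥ P.rep = 0

/-- The envelope of the reflected lines: all points of contact, a point of contact being the
characteristic point at a parameter `m` that has exactly one characteristic point
(at a stationary line of the family the two equations above coincide and single out no point). -/
def reflectedEnvelope (F : Poly) (S : P2) : Set P2 :=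
  {P | ∃ m ∈ mirrorDomain F S, ∀ P', IsCharacteristicPoint F S m P' ↔ P' = P}

/-- The caustic by reflection of the mirror curve `V(F)` with source `S`: the Zariski closure of
the envelope of the reflected lines. -/
def caustic (F : Poly) (S : P2) : Set P2 := zariskiClosure (reflectedEnvelope F S)

/-! ### The reflected map describes the reflected lines -/

lemma euler_relation {F : Poly} {d : ℕ} (hF : F.IsHomogeneous d) {a : Vec} (ha : eval a F = 0) :
    a 0 * gradAt F a 0 + a 1 * gradAt F a 1 + a 2 * gradAt F a 2 = 0 := by
  have h := congrArg (eval a) hF.sum_X_mul_pderiv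
  simpa [Fin.sum_univ_three, ha, gradAt] using h

/-- On the domain of definition, the line `u X + v Y + w Z = 0` is the reflected line. -/
theorem mem_reflectedLine_iff {F : Poly} {d : ℕ} (hF : F.IsHomogeneous d) {S m : P2}
    (hm : m ∈ mirrorDomain F S) (P : P2) :
    P ∈ reflectedLine F S m ↔ reflectedAt F S.rep m.rep ⬝ᵥ P.rep = 0 := by
  obtain ⟨hmF, hm'⟩ := hm
  have hE := euler_relation hF (show eval m.rep F = 0 from hmF)
  have hmS : m ≠ S := fun h => hm' (Or.inl (Or.inl h))
  have hz : m.rep 2 ≠ 0 := fun h =>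
    hm' (Or.inl (Or.inr (show eval m.rep (X 2 : Poly) = 0 by simpa using h)))
  have hQ : gradAt F m.rep 0 ^ 2 + gradAt F m.rep 1 ^ 2 ≠ 0 := fun h =>
    hm' (Or.inr (show eval m.rep (gradSq F) = 0 by simpa [gradSq, gradAt] using h))
  have hp : ¬ (S.rep 0 * m.rep 2 - S.rep 2 * m.rep 0 = 0 ∧
      S.rep 1 * m.rep 2 - S.rep 2 * m.rep 1 = 0) := by
    rintro ⟨h0, h1⟩
    apply hmS
    rw [← Projectivization.mk_rep m, ← Projectivization.mk_rep S]
    symm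
    rw [Projectivization.mk_eq_mk_iff']
    refine ⟨S.rep 2 / m.rep 2, ?_⟩
    funext i
    fin_cases i
    · simp; field_simp; linear_combination -h0
    · simp; field_simp; linear_combination -h1
    · simp; field_simp
  have hI : Complex.I ^ 2 = -1 := Complex.I_sq
  have hu : reflectedAt F S.rep m.rep 0 =
      (S.rep 2 * m.rep 1 - m.rep 2 * S.rep 1) * (gradAt F m.rep 0 ^ 2 + gradAt F m.rep 1 ^ 2) +
      2 * m.rep 2 * (S.rep 0 * gradAt F m.rep 0 + S.rep 1 * gradAt F m.rep 1
        + S.rep 2 * gradAt F m.rep 2) * gradAt F m.rep 1 := by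
    simp [reflectedAt, reflectedMap, gradSq, polar, gradAt]
  have hv : reflectedAt F S.rep m.rep 1 =
      (m.rep 2 * S.rep 0 - S.rep 2 * m.rep 0) * (gradAt F m.rep 0 ^ 2 + gradAt F m.rep 1 ^ 2) -
      2 * m.rep 2 * (S.rep 0 * gradAt F m.rep 0 + S.rep 1 * gradAt F m.rep 1
        + S.rep 2 * gradAt F m.rep 2) * gradAt F m.rep 0 := by
    simp [reflectedAt, reflectedMap, gradSq, polar, gradAt]
  have hw : reflectedAt F S.rep m.rep 2 =
      (m.rep 0 * S.rep 1 - m.rep 1 * S.rep 0) * (gradAt F m.rep 0 ^ 2 + gradAt F m.rep 1 ^ 2) -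
      2 * (S.rep 0 * gradAt F m.rep 0 + S.rep 1 * gradAt F m.rep 1
        + S.rep 2 * gradAt F m.rep 2) *
        (m.rep 0 * gradAt F m.rep 1 - m.rep 1 * gradAt F m.rep 0) := by
    simp [reflectedAt, reflectedMap, gradSq, polar, gradAt]
  have hdet : ∀ q0 q1 : ℂ, P.rep ⬝ᵥ (m.rep ⨯₃ ![q0, q1, 0]) =
      P.rep 1 * m.rep 2 * q0 - P.rep 0 * m.rep 2 * q1
        + P.rep 2 * (m.rep 0 * q1 - m.rep 1 * q0) := by
    intro q0 q1
    simp [cross_apply, dotProduct, Fin.sum_univ_three]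
    ring
  have hdot : reflectedAt F S.rep m.rep ⬝ᵥ P.rep = reflectedAt F S.rep m.rep 0 * P.rep 0
      + reflectedAt F S.rep m.rep 1 * P.rep 1 + reflectedAt F S.rep m.rep 2 * P.rep 2 := by
    simp [dotProduct, Fin.sum_univ_three]
  simp only [reflectedLine, Set.mem_ofPred_eq, IsReflectedDirection, hdet, hdot]
  simp only [cons_val_zero, cons_val_one]
  generalize hud : reflectedAt F S.rep m.rep 0 = u at *
  generalize hvd : reflectedAt F S.rep m.rep 1 = v at *
  generalize hwd : reflectedAt F S.rep m.rep 2 = w at *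
  generalize gradAt F m.rep 0 = gx at *
  generalize gradAt F m.rep 1 = gy at *
  generalize gradAt F m.rep 2 = gz at *
  generalize m.rep 0 = x at *
  generalize m.rep 1 = y at *
  generalize m.rep 2 = z at *
  generalize S.rep 0 = a at *
  generalize S.rep 1 = b at *
  generalize S.rep 2 = c at *
  have hu' : u = -(b * z - c * y) * (gx ^ 2 - gy ^ 2) + 2 * (a * z - c * x) * gx * gy := by
    rw [hu]; linear_combination 2 * c * gy * hE
  have hv' : v = -((a * z - c * x) * (gx ^ 2 - gy ^ 2) + 2 * (b * z - c * y) * gx * gy) := by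
    rw [hv]; linear_combination -2 * c * gx * hE
  have hw' : z * w = -(x * u + y * v) := by
    rw [hu, hv, hw]; ring
  have huv : ¬ (u = 0 ∧ v = 0) := by
    rintro ⟨h0, h1⟩
    rw [hu'] at h0
    rw [hv'] at h1
    have hQ2 := pow_ne_zero 2 hQ
    apply hp
    constructor
    · apply (mul_eq_zero.mp (?_ : (gx ^ 2 + gy ^ 2) ^ 2 * _ = 0)).resolve_left hQ2
      linear_combination 2 * gx * gy * h0 - (gx ^ 2 - gy ^ 2) * h1
    · apply (mul_eq_zero.mp (?_ : (gx ^ 2 + gy ^ 2) ^ 2 * _ = 0)).resolve_left hQ2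
      linear_combination -(gx ^ 2 - gy ^ 2) * h0 - 2 * gx * gy * h1
  have key : ∀ q0 q1 : ℂ,
      (((a * z - c * x) + Complex.I * (b * z - c * y)) * (gy - Complex.I * -gx) *
          ((q0 + Complex.I * q1) * (gy - Complex.I * -gx)) =
        ((a * z - c * x) - Complex.I * (b * z - c * y)) * (gy + Complex.I * -gx) *
          ((q0 - Complex.I * q1) * (gy + Complex.I * -gx))) ↔ q0 * u + q1 * v = 0 := by
    intro q0 q1
    have h2 : (2 * Complex.I) ≠ 0 := by simp
    rw [← sub_eq_zero, ← mul_eq_zero_iff_left h2 (b := q0 * u + q1 * v)]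
    apply Eq.congr_left
    rw [hu', hv']
    ring_nf
    have h3 : Complex.I ^ 3 = -Complex.I := by rw [pow_succ, hI]; ring
    simp only [h3]
    ring
  simp only [key]
  constructor
  · rintro ⟨q, hq0, hq, hP⟩
    have hP' : z * (P.rep 0 * q 1 - P.rep 1 * q 0) - P.rep 2 * (x * q 1 - y * q 0) = 0 := by
      linear_combination -hP
    have h1 : q 1 * (z * (u * P.rep 0 + v * P.rep 1 + w * P.rep 2)) = 0 := by
      linear_combination u * hP' + z * P.rep 1 * hq + q 1 * P.rep 2 * hw' - P.rep 2 * y * hq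
    have h0 : q 0 * (z * (u * P.rep 0 + v * P.rep 1 + w * P.rep 2)) = 0 := by
      linear_combination -v * hP' + z * P.rep 0 * hq + q 0 * P.rep 2 * hw' - P.rep 2 * x * hq
    by_contra hne
    have hne' := mul_ne_zero hz hne
    apply hq0
    funext i
    fin_cases i
    · exact (mul_eq_zero.mp h0).resolve_right hne'
    · exact (mul_eq_zero.mp h1).resolve_right hne'
  · intro h
    refine ⟨![-v, u], ?_, ?_, ?_⟩
    · intro h0
      apply huv
      have h1 := congrFun h0 0
      have h2 := congrFun h0 1
      simp at h1 h2
      exact ⟨h2, h1⟩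
    · simp; ring
    · simp
      linear_combination -z * h + P.rep 2 * hw'

end CausticByReflection

end

open scoped LinearAlgebra.Projectivization

noncomputable section

namespace CausticByReflection

open MvPolynomial Matrix

/-! Write R = (u, v, w) and let D = F_y ∂_x − F_x ∂_y be the derivation along the mirror. A unique
characteristic point exists at m exactly when the vector R × DR is nonzero there, and it is then [R
× DR]. So the envelope is the image of the mirror under `causticMap`, and everything rests on this
map being nonconstant.

If it is nonconstant, the polynomials H with H(R × DR) ≡ 0 mod F form a prime ideal, and a
transcendence degree count makes it principal (`exists_implicit_equation`). Its generator is the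
equation of the caustic.

If it is constant with value p, then R · (R × DR) = 0 shows that all reflected lines pass through p.
Then (s·∇F)(p·∇F)/(F_x² + F_y²), in the affine picture the product of the distances from S and p to
the tangent, has zero derivative along the mirror, hence equals a constant c
(`exists_first_integral`). The tangents t thus lie on the dual conic (s·t)(p·t) = c(t₀² + t₁²). By
biduality the mirror is a conic (`conic_of_common_point`) having S as a focus
(`isFocus_of_common_point`), which is excluded.

Identities on the curve are written as divisibility by F; "zero derivative implies constant" is
`exists_dvd_sub_of_tangentDeriv`. -/

/-! ### Forms modulo `F`: grading, transcendence degree, derivations. -/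

/-- `p` and `q` are algebraically independent modulo `F`. -/
def IndepMod (F p q : Poly) : Prop :=
  ∀ Φ : MvPolynomial (Fin 2) ℂ, F ∣ aeval ![p, q] Φ → Φ = 0

lemma aeval_smul_of_isHomogeneous {σ A : Type*} [CommRing A] [Algebra ℂ A]
    {H : MvPolynomial σ ℂ} {n : ℕ} (hH : H.IsHomogeneous n) (c : A) (v : σ → A) :
    aeval (c • v) H = c ^ n * aeval v H := by
  rw [aeval_def, aeval_def, eval₂_eq, eval₂_eq, Finset.mul_sum]
  refine Finset.sum_congr rfl fun u hu => ?_
  have hdeg := hH.degree_eq_sum_deg_support hu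
  simp only [Pi.smul_apply, smul_eq_mul, mul_pow, Finset.prod_mul_distrib, Finset.prod_pow_eq_pow_sum]
  rw [show ∑ i ∈ u.support, u i = n from hdeg.symm ▸ rfl]
  ring

lemma eval_smul_of_isHomogeneous {σ : Type*} {H : MvPolynomial σ ℂ} {n : ℕ}
    (hH : H.IsHomogeneous n) (c : ℂ) (v : σ → ℂ) : eval (c • v) H = c ^ n * eval v H := by
  simpa [aeval_eq_eval] using aeval_smul_of_isHomogeneous hH c v

lemma dvd_homogeneousComponent {F H : Poly} {d : ℕ} (hF : F.IsHomogeneous d) (h : F ∣ H)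
    (n : ℕ) : F ∣ homogeneousComponent n H := by
  let _ := MvPolynomial.gradedAlgebra (σ := Fin 3) (R := ℂ)
  have hI : (Ideal.span {F}).IsHomogeneous (homogeneousSubmodule (Fin 3) ℂ) := by
    apply Ideal.homogeneous_span
    rintro x rfl
    exact ⟨d, hF⟩
  exact Ideal.mem_span_singleton.mp
    (homogeneousComponent_mem_of_mem hI (Ideal.mem_span_singleton.mpr h) n)

/-- Substituting forms of degree e multiplies degrees by e, and for e > 0 distinct components of H
stay in distinct degrees. -/
lemma homogeneousComponent_aeval {σ : Type*} {N : σ → Poly} {e : ℕ} (he : 0 < e)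
    (hN : ∀ i, (N i).IsHomogeneous e) (H : MvPolynomial σ ℂ) (n : ℕ) :
    homogeneousComponent (e * n) (aeval N H) = aeval N (homogeneousComponent n H) := by
  conv_lhs => rw [← sum_homogeneousComponent H]
  rw [map_sum, map_sum]
  have h : ∀ i, homogeneousComponent (e * n) (aeval N (homogeneousComponent i H)) =
      if i = n then aeval N (homogeneousComponent n H) else 0 := by
    intro i
    rw [homogeneousComponent_of_mem ((homogeneousComponent_isHomogeneous i H).aeval N hN)]
    by_cases hi : i = n
    · simp [hi]
    · rw [if_neg hi, if_neg]
      intro h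
      exact hi (Nat.eq_of_mul_eq_mul_left he h).symm
  simp only [h, Finset.sum_ite_eq', Finset.mem_range]
  split_ifs with hn
  · rfl
  · rw [homogeneousComponent_eq_zero _ _ (by omega), map_zero]

lemma dvd_aeval_homogeneousComponent {σ : Type*} {F : Poly} {d : ℕ} (hF : F.IsHomogeneous d)
    {N : σ → Poly} {e : ℕ} (he : 0 < e) (hN : ∀ i, (N i).IsHomogeneous e)
    {H : MvPolynomial σ ℂ} (h : F ∣ aeval N H) (n : ℕ) :
    F ∣ aeval N (homogeneousComponent n H) := by
  rw [← homogeneousComponent_aeval he hN]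
  exact dvd_homogeneousComponent hF h _

lemma mk_eq_zero_iff_dvd {F p : Poly} : Ideal.Quotient.mkₐ ℂ (Ideal.span {F}) p = 0 ↔ F ∣ p := by
  simp [Ideal.Quotient.eq_zero_iff_mem, Ideal.mem_span_singleton]

lemma isDomain_quotient {F : Poly} (hF : Prime F) : IsDomain (Poly ⧸ Ideal.span {F}) :=
  (Ideal.Quotient.isDomain_iff_prime _).mpr ((Ideal.span_singleton_prime hF.ne_zero).mpr hF)

/-- The three coordinates generate the quotient. With transcendence degree at least 3 they would be
a transcendence basis, against the relation F. -/
lemma trdeg_quotient_le {F : Poly} (hF : Prime F) :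
    Algebra.trdeg ℂ (Poly ⧸ Ideal.span {F}) ≤ 2 := by
  have := isDomain_quotient hF
  by_contra hlt
  have h3 : (3 : Cardinal) ≤ Algebra.trdeg ℂ (Poly ⧸ Ideal.span {F}) := by
    rw [not_le] at hlt
    have := Order.succ_le_of_lt hlt
    rwa [show Order.succ (2 : Cardinal) = 3 by
      rw [← Nat.cast_ofNat, Cardinal.succ_natCast]; norm_num] at this
  let π := Ideal.Quotient.mkₐ ℂ (Ideal.span {F})
  let x : Fin 3 → Poly ⧸ Ideal.span {F} := fun i => π (X i)
  have hadj : Algebra.adjoin ℂ (Set.range x) = ⊤ := by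
    have := congrArg (Subalgebra.map π) (MvPolynomial.adjoin_range_X (σ := Fin 3) (R := ℂ))
    rw [AlgHom.map_adjoin, ← Set.range_comp, Algebra.map_top] at this
    rw [show x = π ∘ X from rfl, this]
    exact (AlgHom.range_eq_top _).mpr (Ideal.Quotient.mkₐ_surjective _ _)
  have : Algebra.IsAlgebraic (Algebra.adjoin ℂ (Set.range x)) (Poly ⧸ Ideal.span {F}) := by
    constructor
    intro a
    have ha : a ∈ Algebra.adjoin ℂ (Set.range x) := hadj ▸ trivial
    exact isAlgebraic_algebraMap (⟨a, ha⟩ : Algebra.adjoin ℂ (Set.range x))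
  have hb := Algebra.IsAlgebraic.isTranscendenceBasis_of_le_trdeg_of_finite ℂ x (by simpa using h3)
  have h0 : aeval x F = 0 := by
    have : aeval x F = π F := by
      have : (aeval x : Poly →ₐ[ℂ] _) = π := by ext i; simp [x]
      rw [this]
    rw [this]
    exact mk_eq_zero_iff_dvd.mpr dvd_rfl
  exact hF.ne_zero (hb.1.eq_zero_of_aeval_eq_zero _ h0)

lemma IndepMod.algebraicIndependent {F p q : Poly} (h : IndepMod F p q) :
    AlgebraicIndependent ℂ ![Ideal.Quotient.mkₐ ℂ (Ideal.span {F}) p,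
      Ideal.Quotient.mkₐ ℂ (Ideal.span {F}) q] := by
  rw [algebraicIndependent_iff]
  intro Φ hΦ
  apply h
  rw [← mk_eq_zero_iff_dvd, ← hΦ, ← AlgHom.comp_apply]
  congr 1
  ext i
  fin_cases i <;> simp

lemma IndepMod.isAlgebraic {F p q : Poly} (hF : Prime F) (h : IndepMod F p q) :
    Algebra.IsAlgebraic (Algebra.adjoin ℂ (Set.range ![Ideal.Quotient.mkₐ ℂ (Ideal.span {F}) p,
      Ideal.Quotient.mkₐ ℂ (Ideal.span {F}) q])) (Poly ⧸ Ideal.span {F}) := by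
  have := isDomain_quotient hF
  exact (h.algebraicIndependent.isTranscendenceBasis_of_trdeg_le_of_finite
    (by simpa using trdeg_quotient_le hF)).isAlgebraic

/-- Two forms of the same degree that are algebraically dependent modulo `F` are proportional
modulo `F`. -/
lemma exists_dvd_sub_of_not_indepMod {F p q : Poly} {d e : ℕ} (hF : F.IsHomogeneous d)
    (hFp : Prime F) (he : 0 < e) (hp : p.IsHomogeneous e) (hq : q.IsHomogeneous e)
    (hFq : ¬ F ∣ q) (h : ¬ IndepMod F p q) : ∃ c : ℂ, F ∣ p - C c * q := by
  have := isDomain_quotient hFp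
  simp only [IndepMod, not_forall] at h
  obtain ⟨Φ, hΦ, hΦ0⟩ := h
  obtain ⟨n, hn⟩ : ∃ n, homogeneousComponent n Φ ≠ 0 := by
    by_contra hcon
    push Not at hcon
    apply hΦ0
    rw [← sum_homogeneousComponent Φ]
    exact Finset.sum_eq_zero fun i _ => hcon i
  have hdvd := dvd_aeval_homogeneousComponent (N := ![p, q]) hF he
    (by intro i; fin_cases i <;> simpa) hΦ n
  have hhom := homogeneousComponent_isHomogeneous n Φ
  generalize homogeneousComponent n Φ = Ψ at hn hdvd hhom
  let K := FractionRing (Poly ⧸ Ideal.span {F})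
  let ρ : Poly →ₐ[ℂ] K := (IsScalarTower.toAlgHom ℂ (Poly ⧸ Ideal.span {F}) K).comp
    (Ideal.Quotient.mkₐ ℂ (Ideal.span {F}))
  have hρ : ∀ x, ρ x = 0 ↔ F ∣ x := by
    intro x
    rw [← mk_eq_zero_iff_dvd]
    exact map_eq_zero_iff _ (IsFractionRing.injective (Poly ⧸ Ideal.span {F}) K)
  have hq0 : ρ q ≠ 0 := fun h0 => hFq ((hρ q).mp h0)
  set g : K := ρ p / ρ q with hg
  have hΨg : aeval ![g, 1] Ψ = (0 : K) := by
    have h1 := (hρ _).mpr hdvd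
    rw [← AlgHom.comp_apply, show ρ.comp (aeval ![p, q]) = aeval (ρ q • ![g, 1]) by
      ext i
      fin_cases i
      · simp [hg, mul_div_cancel₀ _ hq0]
      · simp, aeval_smul_of_isHomogeneous hhom] at h1
    exact (mul_eq_zero.mp h1).resolve_left (pow_ne_zero _ hq0)
  -- Dehomogenising Ψ gives a one-variable polynomial with root p/q; once it is nonzero, p/q is
  -- algebraic over ℂ, hence in ℂ.
  let φ : Polynomial ℂ := aeval ![Polynomial.X, 1] Ψ
  have hφ : ∀ (B : Type) [CommRing B] [Algebra ℂ B] (b : B),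
      Polynomial.aeval b φ = aeval ![b, 1] Ψ := by
    intro B _ _ b
    rw [← AlgHom.comp_apply]
    congr 1
    ext i
    fin_cases i <;> simp
  have hφ0 : φ ≠ 0 := by
    intro h0
    apply hn
    -- φ = 0 kills Ψ only where the second coordinate is nonzero; the factor `X 1` takes care of the
    -- other points.
    have hprod : Ψ * X 1 = 0 := by
      apply MvPolynomial.funext
      intro v
      by_cases hv : v 1 = 0
      · simp [hv]
      · have h1 := hφ ℂ (v 0 / v 1)
        rw [h0, map_zero] at h1
        have h2 := aeval_smul_of_isHomogeneous hhom (v 1) ![v 0 / v 1, 1]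
        rw [← h1, mul_zero, show v 1 • ![v 0 / v 1, 1] = v by
          ext i
          fin_cases i
          · simp [mul_div_cancel₀ _ hv]
          · simp] at h2
        rw [aeval_eq_eval] at h2
        simp [show eval v Ψ = 0 from h2]
    exact (mul_eq_zero.mp hprod).resolve_right (X_ne_zero _)
  have halg : IsAlgebraic ℂ g := ⟨φ, hφ0, by rw [hφ, hΨg]⟩
  obtain ⟨c, hc⟩ : ∃ c : ℂ, algebraMap ℂ K c = g := by
    have hint := halg.isIntegral
    have hdeg := IsAlgClosed.degree_eq_one_of_irreducible ℂ (minpoly.irreducible hint)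
    exact minpoly.mem_range_of_degree_eq_one ℂ g hdeg
  refine ⟨c, (hρ _).mp ?_⟩
  rw [map_sub, map_mul, ← MvPolynomial.algebraMap_eq, AlgHom.commutes, hc, hg, div_mul_cancel₀ _ hq0,
    sub_self]

/-- From f(a) = 0 follows f'(a) δa = 0. If δa ≠ 0, then a is a root of every successive derivative
of f, down to a nonzero constant in characteristic zero. -/
lemma derivation_eq_zero_of_isAlgebraic {A : Type*} [CommRing A] [IsDomain A] [Algebra ℂ A]
    (B : Subalgebra ℂ A) (δ : Derivation ℂ A A) (hB : ∀ b ∈ B, δ b = 0) {a : A}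
    (ha : IsAlgebraic B a) : δ a = 0 := by
  let δ' : Derivation B A A := Derivation.mk'
    { toFun := δ
      map_add' := map_add δ
      map_smul' := by
        intro b x
        rw [Algebra.smul_def, Derivation.leibniz,
          show δ (algebraMap B A b) = 0 from hB _ b.2]
        simp [Algebra.smul_def] }
    (fun x y => δ.leibniz x y)
  have : CharZero B := charZero_of_injective_algebraMap (algebraMap ℂ B).injective
  obtain ⟨f, hf0, hf⟩ := ha
  by_contra hne
  suffices hkey : ∀ n, ∀ f : Polynomial B, f.natDegree = n → f ≠ 0 → Polynomial.aeval a f ≠ 0 from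
    hkey _ f rfl hf0 hf
  intro n
  induction n with
  | zero =>
    intro f hn hf0 hf
    rw [Polynomial.eq_C_of_natDegree_eq_zero hn, Polynomial.aeval_C] at hf
    apply hf0
    rw [Polynomial.eq_C_of_natDegree_eq_zero hn]
    rw [show f.coeff 0 = 0 from Subtype.ext hf, map_zero]
  | succ n ih =>
    intro f hn hf0 hf
    refine ih (Polynomial.derivative f) ?_ ?_ ?_
    · rw [Polynomial.natDegree_derivative, hn, Nat.add_sub_cancel]
    · intro h
      have := Polynomial.derivative_eq_zero.mp h
      omega
    · have h1 : δ' (Polynomial.aeval a f) = 0 := by rw [hf, map_zero]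
      rw [Derivation.map_aeval, smul_eq_mul] at h1
      exact (mul_eq_zero.mp h1).resolve_right hne

lemma derivation_dvd_of_dvd {F h : Poly} (Δ : Derivation ℂ Poly Poly) (hΔ : F ∣ Δ F)
    (hh : F ∣ h) : F ∣ Δ h := by
  obtain ⟨k, rfl⟩ := hh
  rw [Derivation.leibniz]
  exact dvd_add (Dvd.intro _ rfl) (Dvd.dvd.mul_left hΔ _)

/-- p and q form a transcendence basis of the quotient ring, so the derivation induced there
vanishes once it kills both. -/
lemma IndepMod.derivation_dvd {F p q : Poly} (hF : Prime F) (h : IndepMod F p q)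
    (Δ : Derivation ℂ Poly Poly) (hΔ : F ∣ Δ F) (hp : F ∣ Δ p) (hq : F ∣ Δ q) (x : Poly) :
    F ∣ Δ x := by
  have := isDomain_quotient hF
  let π := Ideal.Quotient.mkₐ ℂ (Ideal.span {F})
  have hπ : ∀ x, π x = 0 → π (Δ x) = 0 := fun x hx =>
    mk_eq_zero_iff_dvd.mpr (derivation_dvd_of_dvd Δ hΔ (mk_eq_zero_iff_dvd.mp hx))
  let δ : Derivation ℂ (Poly ⧸ Ideal.span {F}) (Poly ⧸ Ideal.span {F}) :=
    Derivation.liftOfSurjective (f := π) (Ideal.Quotient.mkₐ_surjective _ _) hπ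
  have hδ : ∀ x, δ (π x) = π (Δ x) := fun x =>
    Derivation.liftOfSurjective_apply (f := π) (Ideal.Quotient.mkₐ_surjective _ _) hπ x
  rw [← mk_eq_zero_iff_dvd, ← hδ]
  have halg := h.isAlgebraic hF
  refine derivation_eq_zero_of_isAlgebraic _ δ ?_ (halg.isAlgebraic (π x))
  intro b hb
  have := Derivation.eqOn_adjoin (D1 := δ) (D2 := 0) (s := Set.range ![π p, π q]) ?_ hb
  · simpa using this
  · rintro _ ⟨i, rfl⟩
    fin_cases i
    · exact (hδ p).trans (mk_eq_zero_iff_dvd.mpr hp)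
    · exact (hδ q).trans (mk_eq_zero_iff_dvd.mpr hq)

/-! ### Constancy along the curve, and equations of images. -/

/-- The derivation `F_y ∂_x - F_x ∂_y`, tangent to the curve `V(F)`. -/
def tangentDeriv (F : Poly) : Derivation ℂ Poly Poly :=
  pderiv 1 F • pderiv 0 - pderiv 0 F • pderiv 1

lemma tangentDeriv_apply (F p : Poly) :
    tangentDeriv F p = pderiv 1 F * pderiv 0 p - pderiv 0 F * pderiv 1 p := by
  simp [tangentDeriv]

lemma tangentDeriv_self (F : Poly) : tangentDeriv F F = 0 := by
  rw [tangentDeriv_apply]; ring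

/-- The Euler derivation `x ∂_x + y ∂_y + z ∂_z`. -/
def eulerDeriv : Derivation ℂ Poly Poly := ∑ i : Fin 3, (X i : Poly) • pderiv i

lemma eulerDeriv_apply {p : Poly} {n : ℕ} (hp : p.IsHomogeneous n) :
    eulerDeriv p = (n : Poly) * p := by
  have := hp.sum_X_mul_pderiv
  rw [nsmul_eq_mul] at this
  rw [← this]
  simp [eulerDeriv, Fin.sum_univ_three]

/-- A quotient of forms of the same degree with zero derivative along the curve is constant. -/
lemma exists_dvd_sub_of_tangentDeriv {F p q : Poly} {d e : ℕ} (hF : F.IsHomogeneous d)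
    (hFp : Prime F) (hz : ¬ F ∣ X 2) (hgrad : ¬ (F ∣ pderiv 0 F ∧ F ∣ pderiv 1 F)) (he : 0 < e)
    (hp : p.IsHomogeneous e) (hq : q.IsHomogeneous e) (hFq : ¬ F ∣ q)
    (h : F ∣ q * tangentDeriv F p - p * tangentDeriv F q) : ∃ c : ℂ, F ∣ p - C c * q := by
  by_contra hcon
  have hind : IndepMod F p q := by
    by_contra h'
    exact hcon (exists_dvd_sub_of_not_indepMod hF hFp he hp hq hFq h')
  -- The Euler derivation multiplies p and q by e, so this combination kills q identically and sends
  -- p to e(q Dp − p Dq), which F divides.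
  let Δ : Derivation ℂ Poly Poly :=
    ((e : Poly) * q) • tangentDeriv F - tangentDeriv F q • eulerDeriv
  have hΔ : ∀ x, Δ x = (e : Poly) * q * tangentDeriv F x - tangentDeriv F q * eulerDeriv x := by
    intro x; simp [Δ]
  have heul : ∀ i, eulerDeriv (X i) = X i := by
    intro i
    rw [eulerDeriv_apply (isHomogeneous_X ℂ i)]
    simp
  have hall := hind.derivation_dvd hFp Δ
    (by rw [hΔ, tangentDeriv_self, eulerDeriv_apply hF]
        exact ⟨- (tangentDeriv F q * d), by ring⟩)
    (by rw [hΔ, eulerDeriv_apply hp]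
        have := h.mul_left (e : Poly)
        convert this using 1
        ring)
    (by rw [hΔ, eulerDeriv_apply hq]
        convert dvd_zero F using 1
        ring)
  -- Since Dz = 0, Δz is −(Dq) z.
  have hDq : F ∣ tangentDeriv F q := by
    have h2 := hall (X 2)
    rw [hΔ, heul, tangentDeriv_apply, pderiv_X_of_ne (by decide), pderiv_X_of_ne (by decide),
      mul_zero, mul_zero, sub_zero, mul_zero, zero_sub, dvd_neg] at h2
    exact (hFp.dvd_or_dvd h2).resolve_right hz
  have hge : ¬ F ∣ (e : Poly) * q := by
    intro h'
    rcases hFp.dvd_or_dvd h' with h' | h'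
    · apply hFp.not_isUnit
      refine isUnit_of_dvd_unit h' ?_
      rw [← map_natCast (C : ℂ →+* Poly)]
      exact (IsUnit.mk0 (e : ℂ) (by exact_mod_cast he.ne')).map C
    · exact hFq h'
  apply hgrad
  have key : ∀ i, F ∣ tangentDeriv F (X i) := by
    intro i
    have h2 := hall (X i)
    rw [hΔ] at h2
    have h3 := (dvd_sub_left (hDq.mul_right (eulerDeriv (X i)))).mp h2
    exact (hFp.dvd_or_dvd h3).resolve_left hge
  have h0 := key 0
  have h1 := key 1
  rw [tangentDeriv_apply, pderiv_X_self, pderiv_X_of_ne (by decide), mul_zero, sub_zero,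
    mul_one] at h0
  rw [tangentDeriv_apply, pderiv_X_self, pderiv_X_of_ne (by decide), mul_zero, zero_sub,
    mul_one, dvd_neg] at h1
  exact ⟨h1, h0⟩

/-- The closure of the image of a nonconstant map `[N₀ : N₁ : N₂]` from the curve `V(F)` to the
plane is defined by one irreducible form. -/
lemma exists_implicit_equation {F : Poly} {d e : ℕ} (hF : F.IsHomogeneous d) (hFp : Prime F)
    (he : 0 < e) {N : Fin 3 → Poly} (hN : ∀ i, (N i).IsHomogeneous e) {i j : Fin 3}
    (hij : IndepMod F (N i) (N j)) :
    ∃ (G : Poly) (n : ℕ), G.IsHomogeneous n ∧ Irreducible G ∧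
      ∀ H : Poly, F ∣ aeval N H ↔ G ∣ H := by
  have hmulF : ∀ {a b : Poly}, F ∣ aeval N (a * b) → F ∣ aeval N a ∨ F ∣ aeval N b := by
    intro a b h
    rw [map_mul] at h
    exact hFp.dvd_or_dvd h
  have hunit : ∀ u : Poly, IsUnit u → ¬ F ∣ aeval N u := by
    intro u hu h
    exact hFp.not_isUnit (isUnit_of_dvd_unit h (hu.map _))
  -- Three algebraically independent elements would exceed transcendence degree 2.
  have hex : ∃ G₀ : Poly, G₀ ≠ 0 ∧ F ∣ aeval N G₀ := by
    by_contra hcon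
    push Not at hcon
    have hind : AlgebraicIndependent ℂ
        (fun k => Ideal.Quotient.mkₐ ℂ (Ideal.span {F}) (N k)) := by
      rw [algebraicIndependent_iff]
      intro Φ hΦ
      by_contra h0
      apply hcon Φ h0
      rw [← mk_eq_zero_iff_dvd, ← hΦ, ← AlgHom.comp_apply]
      congr 1
      ext k
      simp
    have h1 := hind.cardinalMk_le_trdeg.trans (trdeg_quotient_le hFp)
    norm_num at h1
  obtain ⟨G, hGirr, hG⟩ : ∃ G : Poly, Irreducible G ∧ F ∣ aeval N G := by
    obtain ⟨G₀, h0, hG₀⟩ := hex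
    revert h0 hG₀
    refine WfDvdMonoid.induction_on_irreducible G₀ (fun h => absurd rfl h)
      (fun u hu _ h => absurd h (hunit u hu)) ?_
    intro a b ha0 hb ih _ h
    rcases hmulF h with h | h
    · exact ⟨b, hb, h⟩
    · exact ih ha0 h
  have hGp : Prime G := hGirr.prime
  have hind' : IndepMod G (X i) (X j) := by
    intro Φ hΦ
    apply hij
    have h1 : aeval N (aeval ![(X i : Poly), X j] Φ) = aeval ![N i, N j] Φ := by
      rw [← AlgHom.comp_apply]
      congr 1
      ext k
      fin_cases k <;> simp
    rw [← h1]
    exact hG.trans (map_dvd (aeval N) hΦ)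
  have hdvd : ∀ H : Poly, F ∣ aeval N H ↔ G ∣ H := by
    intro H
    refine ⟨fun hH => ?_, fun h => hG.trans (map_dvd (aeval N) h)⟩
    have := isDomain_quotient hGp
    by_contra hGH
    let π := Ideal.Quotient.mkₐ ℂ (Ideal.span {G})
    have hH0 : π H ≠ 0 := fun h => hGH (mk_eq_zero_iff_dvd.mp h)
    -- Modulo G everything is algebraic over ℂ[X i, X j], so H divides there a nonzero Φ(X i, X j).
    -- Substituting N turns this into F ∣ Φ(N i, N j), against `hij`.
    obtain ⟨⟨r, hr⟩, hr0, hdr⟩ := ((hind'.isAlgebraic hGp).isAlgebraic (π H)).exists_nonzero_dvd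
      (mem_nonZeroDivisors_of_ne_zero hH0)
    change π H ∣ r at hdr
    rw [Algebra.adjoin_range_eq_range_aeval] at hr
    obtain ⟨Φ, rfl⟩ := hr
    have hΦ : (aeval ![π (X i), π (X j)]) Φ = π (aeval ![(X i : Poly), X j] Φ) := by
      rw [← AlgHom.comp_apply]
      congr 1
      ext k
      fin_cases k <;> simp [π]
    apply hr0
    apply Subtype.ext
    suffices Φ = 0 by simp [this]
    apply hij
    obtain ⟨k, hk⟩ := hdr
    obtain ⟨k, rfl⟩ := Ideal.Quotient.mkₐ_surjective ℂ _ k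
    have h2 : π (aeval ![(X i : Poly), X j] Φ - H * k) = 0 := by
      rw [map_sub, ← hΦ, map_mul]
      exact sub_eq_zero.mpr hk
    have h3 := hG.trans (map_dvd (aeval N) (mk_eq_zero_iff_dvd.mp h2))
    rw [map_sub, map_mul, dvd_sub_left (hH.mul_right _), ← AlgHom.comp_apply] at h3
    convert h3 using 2
    ext k
    fin_cases k <;> simp
  -- G is homogeneous: a nonzero component of G also vanishes on the image, so it is a multiple of
  -- G, and degrees force the cofactor to be a constant.
  obtain ⟨n, hn⟩ : ∃ n, homogeneousComponent n G ≠ 0 := by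
    by_contra hcon
    push Not at hcon
    apply hGirr.ne_zero
    rw [← sum_homogeneousComponent G]
    exact Finset.sum_eq_zero fun i _ => hcon i
  obtain ⟨k, hk⟩ := (hdvd _).mp (dvd_aeval_homogeneousComponent hF he hN hG n)
  have hhom := homogeneousComponent_isHomogeneous n G
  have hk0 : k ≠ 0 := by
    rintro rfl
    exact hn (by rw [hk, mul_zero])
  have hdeg : G.totalDegree + k.totalDegree = n := by
    rw [← totalDegree_mul_of_isDomain hGirr.ne_zero hk0, ← hk]
    exact hhom.totalDegree hn
  have hle : n ≤ G.totalDegree := by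
    by_contra h
    exact hn (homogeneousComponent_eq_zero _ _ (by omega))
  have hkC := totalDegree_eq_zero_iff_eq_C.mp (show k.totalDegree = 0 by omega)
  have hc : coeff 0 k ≠ 0 := by
    intro h
    rw [h, map_zero] at hkC
    exact hk0 hkC
  refine ⟨G, n, ?_, hGirr, hdvd⟩
  have hGeq : G = C (coeff 0 k)⁻¹ * homogeneousComponent n G := by
    rw [hk, hkC, coeff_C, if_pos rfl, mul_left_comm, ← C_mul, inv_mul_cancel₀ hc, C_1, mul_one]
  rw [hGeq]
  exact hhom.C_mul _

/-! ### Linear forms, polars and partial derivatives are nonzero on the curve. -/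

/-- The linear form with coefficient vector `v`. -/
def linForm (v : Vec) : Poly := ∑ i, C (v i) * X i

lemma linForm_isHomogeneous (v : Vec) : (linForm v).IsHomogeneous 1 :=
  IsHomogeneous.sum _ _ _ fun i _ => isHomogeneous_C_mul_X (v i) i

lemma eval_linForm (v a : Vec) : eval a (linForm v) = v ⬝ᵥ a := by
  simp [linForm, dotProduct]

lemma linForm_ne_zero {v : Vec} (hv : v ≠ 0) : linForm v ≠ 0 := by
  intro h
  apply hv
  funext i
  have := eval_linForm v (Pi.single i 1)
  simpa [h] using this.symm

lemma two_le_degree {F : Poly} {d : ℕ} (hF : F.IsHomogeneous d) (hirr : Irreducible F)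
    (hd : d ≠ 1) : 2 ≤ d := by
  rcases Nat.lt_or_ge d 2 with h | h
  · exfalso
    obtain rfl : d = 0 := by omega
    have h1 := totalDegree_eq_zero_iff_eq_C.mp (hF.totalDegree hirr.ne_zero)
    apply hirr.not_isUnit
    rw [h1]
    refine (IsUnit.mk0 _ ?_).map C
    intro h0
    rw [h0, map_zero] at h1
    exact hirr.ne_zero h1
  · exact h

lemma degree_le_of_dvd {F G : Poly} {d e : ℕ} (hF : F.IsHomogeneous d) (hG : G.IsHomogeneous e)
    (hG0 : G ≠ 0) (h : F ∣ G) : d ≤ e := by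
  obtain ⟨k, rfl⟩ := h
  have hF0 : F ≠ 0 := left_ne_zero_of_mul hG0
  have hk0 : k ≠ 0 := right_ne_zero_of_mul hG0
  have h1 := totalDegree_mul_of_isDomain hF0 hk0
  rw [hG.totalDegree hG0, hF.totalDegree hF0] at h1
  omega

lemma not_dvd_linForm {F : Poly} {d : ℕ} (hF : F.IsHomogeneous d) (hd : 2 ≤ d) {v : Vec}
    (hv : v ≠ 0) : ¬ F ∣ linForm v := fun h => by
  have := degree_le_of_dvd hF (linForm_isHomogeneous v) (linForm_ne_zero hv) h
  omega

lemma not_dvd_X {F : Poly} {d : ℕ} (hF : F.IsHomogeneous d) (hd : 2 ≤ d) (i : Fin 3) :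
    ¬ F ∣ X i := fun h => by
  have := degree_le_of_dvd hF (isHomogeneous_X ℂ i) (X_ne_zero i) h
  omega

/-- If F divides its derivative along v, the constant field ∂_v acts modulo F. It kills the linear
forms vanishing at v; two non-proportional ones are independent modulo F, so ∂_v would kill every
coordinate, although ∂_v x_k = v_k. -/
lemma dvd_polar_imp_eq_zero {F : Poly} {d : ℕ} (hF : F.IsHomogeneous d) (hirr : Irreducible F)
    (hd : 2 ≤ d) {v : Vec} (h : F ∣ polar v F) : v = 0 := by
  by_contra hv
  obtain ⟨k, hk⟩ := Function.ne_iff.mp hv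
  let Δ : Derivation ℂ Poly Poly := ∑ i, v i • pderiv i
  have hΔ : ∀ w, Δ (linForm w) = C (w ⬝ᵥ v) := by
    intro w
    simp [Δ, linForm, Fin.sum_univ_three, dotProduct, pderiv_X, smul_eq_C_mul]
    ring
  have hΔF : F ∣ Δ F := by
    convert h using 1
    simp [Δ, polar, Fin.sum_univ_three, smul_eq_C_mul]
  have hindep : ∀ p q : Vec, p ⬝ᵥ v = 0 → q ⬝ᵥ v = 0 → q ≠ 0 → ∃ c : ℂ, p = c • q := by
    intro p q hp hq hq0
    by_contra hcon
    push Not at hcon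
    have hind : IndepMod F (linForm p) (linForm q) := by
      by_contra hn
      obtain ⟨c, hc⟩ := exists_dvd_sub_of_not_indepMod hF hirr.prime one_pos
        (linForm_isHomogeneous p) (linForm_isHomogeneous q) (not_dvd_linForm hF hd hq0) hn
      refine not_dvd_linForm hF hd (sub_ne_zero.mpr (hcon c)) ?_
      convert hc using 1
      simp [linForm, Fin.sum_univ_three]
      ring
    have := hind.derivation_dvd hirr.prime Δ hΔF (by simp [hΔ, hp]) (by simp [hΔ, hq])
      (linForm (Pi.single k 1))
    rw [hΔ] at this
    apply hirr.not_isUnit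
    refine isUnit_of_dvd_unit this ((IsUnit.mk0 _ ?_).map C)
    simpa using hk
  have hk' : v k ≠ 0 := hk
  -- In each case the two chosen linear forms vanish at v and are non-proportional because v_k ≠ 0.
  fin_cases k
  · obtain ⟨c, hc⟩ := hindep ![v 1, -v 0, 0] ![v 2, 0, -v 0]
      (by simp [dotProduct, Fin.sum_univ_three]; ring)
      (by simp [dotProduct, Fin.sum_univ_three]; ring)
      (fun h0 => hk' (by simpa using congrFun h0 2))
    exact hk' (by simpa using congrFun hc 1)
  · obtain ⟨c, hc⟩ := hindep ![v 1, -v 0, 0] ![0, v 2, -v 1]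
      (by simp [dotProduct, Fin.sum_univ_three]; ring)
      (by simp [dotProduct, Fin.sum_univ_three]; ring)
      (fun h0 => hk' (by simpa using congrFun h0 2))
    exact hk' (by simpa using congrFun hc 0)
  · obtain ⟨c, hc⟩ := hindep ![v 2, 0, -v 0] ![0, v 2, -v 1]
      (by simp [dotProduct, Fin.sum_univ_three]; ring)
      (by simp [dotProduct, Fin.sum_univ_three]; ring)
      (fun h0 => hk' (by simpa using congrFun h0 1))
    exact hk' (by simpa using congrFun hc 0)

lemma polar_isHomogeneous {F : Poly} {d : ℕ} (hF : F.IsHomogeneous d) (s : Vec) :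
    (polar s F).IsHomogeneous (d - 1) :=
  ((hF.pderiv.C_mul _).add (hF.pderiv.C_mul _)).add (hF.pderiv.C_mul _)

lemma gradSq_isHomogeneous {F : Poly} {d : ℕ} (hF : F.IsHomogeneous d) :
    (gradSq F).IsHomogeneous ((d - 1) + (d - 1)) := by
  rw [← mul_two]
  exact (hF.pderiv.pow 2).add (hF.pderiv.pow 2)

/-- F_x² + F_y² is the product of the polars of I and J. -/
lemma not_dvd_gradSq {F : Poly} {d : ℕ} (hF : F.IsHomogeneous d) (hirr : Irreducible F)
    (hd : 2 ≤ d) : ¬ F ∣ gradSq F := by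
  intro h
  have hI : (C Complex.I : Poly) ^ 2 = -1 := by rw [← C_pow, Complex.I_sq]; simp
  have hfac : gradSq F = polar ![1, Complex.I, 0] F * polar ![1, -Complex.I, 0] F := by
    simp [gradSq, polar]
    linear_combination (pderiv 1 F) ^ 2 * hI
  rw [hfac] at h
  rcases hirr.prime.dvd_or_dvd h with h | h
  · simpa using congrFun (dvd_polar_imp_eq_zero hF hirr hd h) 0
  · simpa using congrFun (dvd_polar_imp_eq_zero hF hirr hd h) 0

lemma not_dvd_pderiv {F : Poly} {d : ℕ} (hF : F.IsHomogeneous d) (hirr : Irreducible F)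
    (hd : 2 ≤ d) (i : Fin 3) : ¬ F ∣ pderiv i F := by
  intro h
  have := dvd_polar_imp_eq_zero hF hirr hd (v := Pi.single i 1) (by
    convert h using 1
    fin_cases i <;> simp [polar])
  simpa using congrFun this i

/-! ### Reflected lines through a common point force a conic. -/

/-- The equation of the reflected line, the point having coordinates `P`. -/
def reflectedEq (F : Poly) (s P : Vec) : Poly := ∑ i, C (P i) * reflectedMap F s i

section FirstIntegral

variable {A : Type*} [CommRing A] [IsDomain A]

/-- Here f is ∇F and g is D∇F; the conclusion is the numerator of the derivative of (s·f)(p·f)/(f₀²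
+ f₁²). After multiplication by z² and use of the Euler relations it is a multiple of the reflected
equation at p, with factor f₀g₁ − f₁g₀ up to sign. -/
lemma first_integral_aux {s0 s1 s2 p0 p1 p2 x y z f0 f1 f2 g0 g1 g2 : A} (hz : z ≠ 0)
    (hm : x * f0 + y * f1 + z * f2 = 0) (hg : x * g0 + y * g1 + z * g2 = 0)
    (hR : p0 * ((s2 * y - z * s1) * (f0 ^ 2 + f1 ^ 2) + 2 * z * (s0 * f0 + s1 * f1 + s2 * f2) * f1)
      + p1 * ((z * s0 - s2 * x) * (f0 ^ 2 + f1 ^ 2) - 2 * z * (s0 * f0 + s1 * f1 + s2 * f2) * f0)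
      + p2 * ((x * s1 - y * s0) * (f0 ^ 2 + f1 ^ 2)
        - 2 * (s0 * f0 + s1 * f1 + s2 * f2) * (x * f1 - y * f0)) = 0) :
    (f0 ^ 2 + f1 ^ 2) * ((s0 * g0 + s1 * g1 + s2 * g2) * (p0 * f0 + p1 * f1 + p2 * f2)
      + (s0 * f0 + s1 * f1 + s2 * f2) * (p0 * g0 + p1 * g1 + p2 * g2))
      - (s0 * f0 + s1 * f1 + s2 * f2) * (p0 * f0 + p1 * f1 + p2 * f2)
        * (2 * (f0 * g0 + f1 * g1)) = 0 := by
  have hsf : z * (s0 * f0 + s1 * f1 + s2 * f2) = f0 * (s0 * z - s2 * x) + f1 * (s1 * z - s2 * y) := by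
    linear_combination s2 * hm
  have hpf : z * (p0 * f0 + p1 * f1 + p2 * f2) = f0 * (p0 * z - p2 * x) + f1 * (p1 * z - p2 * y) := by
    linear_combination p2 * hm
  have hsg : z * (s0 * g0 + s1 * g1 + s2 * g2) = g0 * (s0 * z - s2 * x) + g1 * (s1 * z - s2 * y) := by
    linear_combination s2 * hg
  have hpg : z * (p0 * g0 + p1 * g1 + p2 * g2) = g0 * (p0 * z - p2 * x) + g1 * (p1 * z - p2 * y) := by
    linear_combination p2 * hg
  generalize s0 * f0 + s1 * f1 + s2 * f2 = σ at *
  generalize p0 * f0 + p1 * f1 + p2 * f2 = ρ at *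
  generalize s0 * g0 + s1 * g1 + s2 * g2 = σ' at *
  generalize p0 * g0 + p1 * g1 + p2 * g2 = ρ' at *
  have key : z ^ 2 * ((f0 ^ 2 + f1 ^ 2) * (σ' * ρ + σ * ρ') - σ * ρ * (2 * (f0 * g0 + f1 * g1)))
      = 0 := by
    have h1 : z ^ 2 * ((f0 ^ 2 + f1 ^ 2) * (σ' * ρ + σ * ρ') - σ * ρ * (2 * (f0 * g0 + f1 * g1)))
      = (f0 ^ 2 + f1 ^ 2) * ((z * σ') * (z * ρ) + (z * σ) * (z * ρ'))
        - (z * σ) * (z * ρ) * (2 * (f0 * g0 + f1 * g1)) := by ring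
    rw [h1, hpf, hsg, hpg]
    have hR' : z * (p0 * ((s2 * y - z * s1) * (f0 ^ 2 + f1 ^ 2) + 2 * (z * σ) * f1)
      + p1 * ((z * s0 - s2 * x) * (f0 ^ 2 + f1 ^ 2) - 2 * (z * σ) * f0))
      + p2 * (z * (x * s1 - y * s0) * (f0 ^ 2 + f1 ^ 2)
        - 2 * (z * σ) * (x * f1 - y * f0)) = 0 := by linear_combination z * hR
    rw [hsf] at hR' ⊢
    linear_combination -(f0 * g1 - f1 * g0) * hR'
  exact (mul_eq_zero.mp key).resolve_left (pow_ne_zero 2 hz)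

/-- The vectors orthogonal to both f and g form a line, because a minor is nonzero. -/
lemma proportional_aux {x y z f0 f1 f2 g0 g1 g2 w0 w1 w2 : A}
    (hn : f0 * g1 - f1 * g0 ≠ 0)
    (hm : x * f0 + y * f1 + z * f2 = 0) (hg : x * g0 + y * g1 + z * g2 = 0)
    (hwf : w0 * f0 + w1 * f1 + w2 * f2 = 0) (hwg : w0 * g0 + w1 * g1 + w2 * g2 = 0) :
    z * w0 = w2 * x ∧ z * w1 = w2 * y := by
  constructor
  · refine mul_left_cancel₀ hn ?_
    linear_combination z * g1 * hwf - z * f1 * hwg - w2 * g1 * hm + w2 * f1 * hg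
  · refine mul_left_cancel₀ hn ?_
    linear_combination -z * g0 * hwf + z * f0 * hwg + w2 * g0 * hm - w2 * f0 * hg

end FirstIntegral

/-- The matrix of the quadratic form `2 ((s·t) (p·t) - c (t₀² + t₁²))` of the dual plane. -/
def focalMatrix (s p : Vec) (c : ℂ) : Matrix (Fin 3) (Fin 3) ℂ :=
  vecMulVec s p + vecMulVec p s - (2 * c) • diagonal ![1, 1, 0]

lemma focalMatrix_mulVec (s p : Vec) (c : ℂ) (t : Vec) (i : Fin 3) :
    (focalMatrix s p c *ᵥ t) i =
      s i * (p ⬝ᵥ t) + p i * (s ⬝ᵥ t) - 2 * c * (![1, 1, 0] i * t i) := by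
  fin_cases i <;> simp [focalMatrix, mulVec, dotProduct, Fin.sum_univ_three, vecMulVec_apply] <;>
    ring

lemma focalMatrix_transpose (s p : Vec) (c : ℂ) : (focalMatrix s p c)ᵀ = focalMatrix s p c := by
  simp [focalMatrix, transpose_vecMulVec, add_comm]

lemma focalMatrix_dotProduct (s p : Vec) (c : ℂ) (t : Vec) :
    (focalMatrix s p c *ᵥ t) ⬝ᵥ t = 2 * ((s ⬝ᵥ t) * (p ⬝ᵥ t) - c * (t 0 ^ 2 + t 1 ^ 2)) := by
  simp only [dotProduct, Fin.sum_univ_three, focalMatrix_mulVec]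
  simp
  ring

/-- Since t₀² + t₁² = (I·t)(J·t), unique factorisation would make s proportional to I or J, or else
s or p zero. -/
lemma focalMatrix_ne_zero {s p : Vec} (hp : p ≠ 0)
    (hIJ : s 2 = 0 → s 0 ^ 2 + s 1 ^ 2 ≠ 0) (c : ℂ) : focalMatrix s p c ≠ 0 := by
  intro h
  have e := fun i j => congrFun (congrFun h i) j
  have e00 := e 0 0
  have e01 := e 0 1
  have e02 := e 0 2
  have e11 := e 1 1
  have e12 := e 1 2
  have e22 := e 2 2
  simp [focalMatrix, vecMulVec_apply] at e00 e01 e02 e11 e12 e22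
  have hs2 : s 2 = 0 := by
    by_contra hs2
    have hp2 : p 2 = 0 := by
      refine (mul_eq_zero.mp (?_ : (2 * s 2) * p 2 = 0)).resolve_left (by simpa using hs2)
      linear_combination e22
    rw [hp2] at e02 e12
    apply hp
    funext i
    fin_cases i
    · exact (mul_eq_zero.mp (by linear_combination e02 : p 0 * s 2 = 0)).resolve_right hs2
    · exact (mul_eq_zero.mp (by linear_combination e12 : p 1 * s 2 = 0)).resolve_right hs2
    · exact hp2
  have hQ := hIJ hs2
  rw [hs2] at e02 e12
  have hc : c = 0 := by
    refine (mul_eq_zero.mp (?_ : (s 0 ^ 2 + s 1 ^ 2) * c = 0)).resolve_left hQ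
    linear_combination s 0 * s 1 * e01 - s 0 ^ 2 * e11 / 2 - s 1 ^ 2 * e00 / 2
  rw [hc] at e00 e11
  apply hp
  funext i
  fin_cases i
  · refine (mul_eq_zero.mp (?_ : (s 0 ^ 2 + s 1 ^ 2) * p 0 = 0)).resolve_left hQ
    linear_combination s 0 * e00 / 2 + s 1 * e01 - s 0 * e11 / 2
  · refine (mul_eq_zero.mp (?_ : (s 0 ^ 2 + s 1 ^ 2) * p 1 = 0)).resolve_left hQ
    linear_combination s 1 * e11 / 2 + s 0 * e01 - s 1 * e00 / 2
  · by_cases h0 : s 0 = 0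
    · have h1 : s 1 ≠ 0 := fun h1 => hQ (by rw [h0, h1]; ring)
      exact (mul_eq_zero.mp (by linear_combination e12 : s 1 * p 2 = 0)).resolve_left h1
    · exact (mul_eq_zero.mp (by linear_combination e02 : s 0 * p 2 = 0)).resolve_left h0

/-- The quadratic form with matrix `N`. -/
def quadForm (N : Matrix (Fin 3) (Fin 3) ℂ) : Poly := ∑ i, ∑ j, C (N i j) * X i * X j

lemma quadForm_isHomogeneous (N : Matrix (Fin 3) (Fin 3) ℂ) : (quadForm N).IsHomogeneous 2 :=
  IsHomogeneous.sum _ _ _ fun i _ => IsHomogeneous.sum _ _ _ fun j _ =>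
    (isHomogeneous_C_mul_X (N i j) i).mul (isHomogeneous_X ℂ j)

lemma eval_quadForm (N : Matrix (Fin 3) (Fin 3) ℂ) (a : Vec) :
    eval a (quadForm N) = a ⬝ᵥ (N *ᵥ a) := by
  simp [quadForm, mulVec, dotProduct, Fin.sum_univ_three]
  ring

lemma gradAt_quadForm {N : Matrix (Fin 3) (Fin 3) ℂ} (hN : Nᵀ = N) (a : Vec) :
    gradAt (quadForm N) a = 2 • (N *ᵥ a) := by
  have e := fun i j => congrFun (congrFun hN i) j
  have e10 := e 1 0
  have e20 := e 2 0
  have e21 := e 2 1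
  simp only [transpose_apply] at e10 e20 e21
  funext i
  fin_cases i <;>
  simp [gradAt, quadForm, mulVec, dotProduct, Fin.sum_univ_three, pderiv_X, ← e10, ← e20, ← e21] <;>
  ring

lemma tangentDeriv_C (F : Poly) (c : ℂ) : tangentDeriv F (C c) = 0 :=
  Derivation.map_algebraMap _ c

lemma tangentDeriv_polar (F : Poly) (s : Vec) : tangentDeriv F (polar s F) =
    C (s 0) * tangentDeriv F (pderiv 0 F) + C (s 1) * tangentDeriv F (pderiv 1 F)
      + C (s 2) * tangentDeriv F (pderiv 2 F) := by
  simp only [polar, map_add, Derivation.leibniz, tangentDeriv_C, smul_eq_mul]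
  ring

lemma tangentDeriv_gradSq (F : Poly) : tangentDeriv F (gradSq F) =
    2 * (pderiv 0 F * tangentDeriv F (pderiv 0 F) + pderiv 1 F * tangentDeriv F (pderiv 1 F)) := by
  simp only [gradSq, map_add, pow_two, Derivation.leibniz, smul_eq_mul]
  ring

lemma dvd_euler {F : Poly} {d : ℕ} (hF : F.IsHomogeneous d) :
    F ∣ X 0 * pderiv 0 F + X 1 * pderiv 1 F + X 2 * pderiv 2 F := by
  have h := hF.sum_X_mul_pderiv
  rw [Fin.sum_univ_three, nsmul_eq_mul] at h
  rw [h]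
  exact Dvd.intro_left _ rfl

lemma dvd_tangentDeriv_euler {F : Poly} {d : ℕ} (hF : F.IsHomogeneous d) :
    F ∣ X 0 * tangentDeriv F (pderiv 0 F) + X 1 * tangentDeriv F (pderiv 1 F)
      + X 2 * tangentDeriv F (pderiv 2 F) := by
  have h := derivation_dvd_of_dvd (tangentDeriv F) (by simp [tangentDeriv_self]) (dvd_euler hF)
  have h0 : tangentDeriv F (X 0) = pderiv 1 F := by
    rw [tangentDeriv_apply, pderiv_X_self, pderiv_X_of_ne (by decide)]; ring
  have h1 : tangentDeriv F (X 1) = -pderiv 0 F := by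
    rw [tangentDeriv_apply, pderiv_X_self, pderiv_X_of_ne (by decide)]; ring
  have h2 : tangentDeriv F (X 2) = 0 := by
    rw [tangentDeriv_apply, pderiv_X_of_ne (by decide), pderiv_X_of_ne (by decide)]; ring
  simp only [map_add, Derivation.leibniz, smul_eq_mul, h0, h1, h2] at h
  convert h using 1
  ring

/-- If the reflected lines all pass through the point `p`, the tangents of the mirror satisfy
`(s·t) (p·t) = c (t₀² + t₁²)` for a constant `c`. -/
lemma exists_first_integral {F : Poly} {d : ℕ} (hF : F.IsHomogeneous d) (hirr : Irreducible F)
    (hd : 2 ≤ d) {s p : Vec} (h : F ∣ reflectedEq F s p) :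
    ∃ c : ℂ, F ∣ polar s F * polar p F - C c * gradSq F := by
  have := isDomain_quotient hirr.prime
  refine exists_dvd_sub_of_tangentDeriv hF hirr.prime (not_dvd_X hF hd 2)
    (fun h' => not_dvd_pderiv hF hirr hd 0 h'.1) (e := (d - 1) + (d - 1)) (by omega)
    ((polar_isHomogeneous hF s).mul (polar_isHomogeneous hF p)) (gradSq_isHomogeneous hF)
    (not_dvd_gradSq hF hirr hd) ?_
  have hm := mk_eq_zero_iff_dvd.mpr (dvd_euler hF)
  have hg := mk_eq_zero_iff_dvd.mpr (dvd_tangentDeriv_euler hF)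
  have hz : Ideal.Quotient.mkₐ ℂ (Ideal.span {F}) (X 2) ≠ 0 := fun h0 =>
    not_dvd_X hF hd 2 (mk_eq_zero_iff_dvd.mp h0)
  have hR := mk_eq_zero_iff_dvd.mpr h
  rw [← mk_eq_zero_iff_dvd, Derivation.leibniz, tangentDeriv_polar, tangentDeriv_polar,
    tangentDeriv_gradSq]
  simp only [reflectedEq, Fin.sum_univ_three, reflectedMap, polar, gradSq, smul_eq_mul, map_add,
    map_sub, map_mul, map_pow, map_ofNat, cons_val_zero, cons_val_one, cons_val] at hm hg hR ⊢
  have key := first_integral_aux hz hm hg hR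
  linear_combination key

/-- Biduality, with M the focal matrix and w = M∇F. The relation `hc` says w·∇F ≡ 0, and
differentiating it gives w·D∇F ≡ 0. The point (x, y, z) satisfies the same two equations. -/
lemma focal_proportional {F : Poly} {d : ℕ} (hF : F.IsHomogeneous d) (hirr : Irreducible F)
    (hd : 2 ≤ d) {s p : Vec} {c : ℂ} (hc : F ∣ polar s F * polar p F - C c * gradSq F)
    {w : Fin 3 → Poly} (hw : ∀ i, w i = polar (focalMatrix s p c i) F) (i : Fin 3) :
    F ∣ X 2 * w i - w 2 * X i := by
  have := isDomain_quotient hirr.prime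
  have hw0 : w 0 = C (s 0) * polar p F + C (p 0) * polar s F - 2 * C c * pderiv 0 F := by
    rw [hw]; simp [polar, focalMatrix, vecMulVec_apply, show (C 2 : Poly) = 2 from rfl]; ring
  have hw1 : w 1 = C (s 1) * polar p F + C (p 1) * polar s F - 2 * C c * pderiv 1 F := by
    rw [hw]; simp [polar, focalMatrix, vecMulVec_apply, show (C 2 : Poly) = 2 from rfl]; ring
  have hw2 : w 2 = C (s 2) * polar p F + C (p 2) * polar s F := by
    rw [hw]; simp [polar, focalMatrix, vecMulVec_apply]; ring
  have hm := mk_eq_zero_iff_dvd.mpr (dvd_euler hF)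
  have hg := mk_eq_zero_iff_dvd.mpr (dvd_tangentDeriv_euler hF)
  -- A vanishing minor would make F_y/F_x constant on the curve, hence a nonzero polar divisible by
  -- F.
  have hn : Ideal.Quotient.mkₐ ℂ (Ideal.span {F}) (pderiv 0 F * tangentDeriv F (pderiv 1 F)
      - pderiv 1 F * tangentDeriv F (pderiv 0 F)) ≠ 0 := by
    intro h0
    obtain ⟨k, hk⟩ := exists_dvd_sub_of_tangentDeriv hF hirr.prime (not_dvd_X hF hd 2)
      (fun h' => not_dvd_pderiv hF hirr hd 0 h'.1) (e := d - 1) (by omega)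
      hF.pderiv hF.pderiv (not_dvd_pderiv hF hirr hd 0) (mk_eq_zero_iff_dvd.mp h0)
    have := dvd_polar_imp_eq_zero hF hirr hd (v := ![-k, 1, 0]) (by
      convert hk using 1
      simp [polar]
      ring)
    simpa using congrFun this 1
  have hwf : F ∣ w 0 * pderiv 0 F + w 1 * pderiv 1 F + w 2 * pderiv 2 F := by
    convert hc.mul_left 2 using 1
    rw [hw0, hw1, hw2]
    simp only [polar, gradSq]
    ring
  have hwg : F ∣ w 0 * tangentDeriv F (pderiv 0 F) + w 1 * tangentDeriv F (pderiv 1 F)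
      + w 2 * tangentDeriv F (pderiv 2 F) := by
    convert derivation_dvd_of_dvd (tangentDeriv F) (by simp [tangentDeriv_self]) hc using 1
    rw [hw0, hw1, hw2]
    simp only [map_sub, Derivation.leibniz, tangentDeriv_C, tangentDeriv_polar,
      tangentDeriv_gradSq, smul_eq_mul]
    simp only [polar]
    ring
  have hwf' := mk_eq_zero_iff_dvd.mpr hwf
  have hwg' := mk_eq_zero_iff_dvd.mpr hwg
  simp only [map_add, map_sub, map_mul] at hm hg hn hwf' hwg'
  have key := proportional_aux hn hm hg hwf' hwg'
  rw [← mk_eq_zero_iff_dvd, map_sub, map_mul, map_mul, sub_eq_zero]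
  fin_cases i
  · exact key.1
  · exact key.2
  · exact mul_comm _ _

lemma polar_vecMul (F : Poly) (n : Vec) (M : Matrix (Fin 3) (Fin 3) ℂ) :
    ∑ i, C (n i) * polar (M i) F = polar (n ᵥ* M) F := by
  simp [polar, vecMul, dotProduct, Fin.sum_univ_three]
  ring

lemma conic_of_common_point {F : Poly} {d : ℕ} (hF : F.IsHomogeneous d) (hirr : Irreducible F)
    (hd : 2 ≤ d) {s p : Vec} (hp : p ≠ 0)
    (hIJ : s 2 = 0 → s 0 ^ 2 + s 1 ^ 2 ≠ 0) (h : F ∣ reflectedEq F s p) :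
    d = 2 ∧ ∃ c κ : ℂ, κ ≠ 0 ∧ ∀ t : Vec, (s ⬝ᵥ t) * (p ⬝ᵥ t) = c * (t 0 ^ 2 + t 1 ^ 2) →
      eval (focalMatrix s p c *ᵥ t) F = 0 ∧ gradAt F (focalMatrix s p c *ᵥ t) = κ • t := by
  obtain ⟨c, hc⟩ := exists_first_integral hF hirr hd h
  have hM0 := focalMatrix_ne_zero hp hIJ c
  have hMt := focalMatrix_transpose s p c
  have hdot := focalMatrix_dotProduct s p c
  obtain ⟨w, hw⟩ : ∃ w : Fin 3 → Poly, ∀ i, w i = polar (focalMatrix s p c i) F :=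
    ⟨fun i => polar (focalMatrix s p c i) F, fun i => rfl⟩
  have hprop := focal_proportional hF hirr hd hc hw
  generalize hM : focalMatrix s p c = M at *
  have hX2 := not_dvd_X hF hd 2
  have hw2 : ¬ F ∣ w 2 := by
    intro h2
    apply hM0
    funext i
    have h3 := (dvd_sub_left (h2.mul_right (X i))).mp (hprop i)
    have h4 := (hirr.prime.dvd_or_dvd h3).resolve_left hX2
    rw [hw] at h4
    exact dvd_polar_imp_eq_zero hF hirr hd h4
  -- A left kernel vector n of M gives n·w = 0; as w is proportional to the point of the curve, the
  -- curve would lie on the line n.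
  have hdet : M.det ≠ 0 := by
    intro h0
    obtain ⟨n, hn0, hn⟩ := exists_vecMul_eq_zero_iff.mpr h0
    have h1 : ∑ i, C (n i) * w i = 0 := by
      simp only [hw, polar_vecMul, hn]
      simp [polar]
    have h2 : F ∣ w 2 * linForm n := by
      have h3 : F ∣ ∑ i, C (n i) * (X 2 * w i - w 2 * X i) :=
        Finset.dvd_sum fun i _ => (hprop i).mul_left _
      rw [← dvd_neg]
      convert h3 using 1
      have : ∑ i, C (n i) * (X 2 * w i - w 2 * X i) =
          X 2 * ∑ i, C (n i) * w i - w 2 * linForm n := by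
        simp only [linForm, Fin.sum_univ_three]
        ring
      rw [this, h1]
      ring
    exact not_dvd_linForm hF hd hn0 ((hirr.prime.dvd_or_dvd h2).resolve_left hw2)
  have hadj : M.adjugate * M = M.det • 1 := adjugate_mul M
  have hNt : M.adjugateᵀ = M.adjugate := by rw [adjugate_transpose, hMt]
  generalize M.adjugate = N at *
  have hNM : ∀ t, N *ᵥ (M *ᵥ t) = M.det • t := by
    intro t
    rw [mulVec_mulVec, hadj, smul_mulVec, one_mulVec]
  -- Modulo F and up to a factor, the point x is M∇F, so x·Nx becomes det(M) x·∇F, which vanishes by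
  -- Euler.
  have hFq : F ∣ quadForm N := by
    have h1 : ∀ i, ∑ j, C (N i j) * w j = C M.det * pderiv i F := by
      intro i
      simp only [hw]
      rw [polar_vecMul, show N i ᵥ* M = (N * M) i from rfl, hadj]
      fin_cases i <;> simp [polar]
    have h2 : w 2 * quadForm N =
        X 2 * (C M.det * (X 0 * pderiv 0 F + X 1 * pderiv 1 F + X 2 * pderiv 2 F))
        - ∑ i, X i * ∑ j, C (N i j) * (X 2 * w j - w 2 * X j) := by
      simp only [Fin.sum_univ_three, quadForm] at *
      linear_combination X 2 * X 0 * h1 0 + X 2 * X 1 * h1 1 + X 2 * X 2 * h1 2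
    have h3 : F ∣ w 2 * quadForm N := by
      rw [h2]
      exact dvd_sub (((dvd_euler hF).mul_left _).mul_left _)
        (Finset.dvd_sum fun i _ => (Finset.dvd_sum fun j _ => (hprop j).mul_left _).mul_left _)
    exact (hirr.prime.dvd_or_dvd h3).resolve_left hw2
  have hq0 : quadForm N ≠ 0 := by
    intro h0
    have h1 := gradAt_quadForm hNt (M *ᵥ Pi.single 0 1)
    rw [h0, hNM] at h1
    have := congrFun h1 0
    simp [gradAt] at this
    exact hdet this
  obtain rfl : d = 2 := le_antisymm (degree_le_of_dvd hF (quadForm_isHomogeneous N) hq0 hFq) hd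
  obtain ⟨k, hk⟩ := hFq
  have hk0 : k ≠ 0 := fun h0 => hq0 (by rw [hk, h0, mul_zero])
  have hkC : k = C (coeff 0 k) := by
    apply totalDegree_eq_zero_iff_eq_C.mp
    have h1 := totalDegree_mul_of_isDomain hirr.ne_zero hk0
    rw [← hk, (quadForm_isHomogeneous N).totalDegree hq0, hF.totalDegree hirr.ne_zero] at h1
    omega
  generalize coeff 0 k = b at hkC
  subst hkC
  have hb : b ≠ 0 := by
    rintro rfl
    exact hk0 (map_zero _)
  -- `quadForm N` is b F, and its gradient at M t is 2 N M t = 2 det(M) t.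
  refine ⟨rfl, c, 2 * M.det / b, by simp [hdet, hb], ?_⟩
  intro t ht
  rw [hM]
  constructor
  · have h1 := eval_quadForm N (M *ᵥ t)
    rw [hNM, dotProduct_smul, hdot, ht, sub_self, mul_zero, smul_zero, hk, map_mul, eval_C] at h1
    exact (mul_eq_zero.mp h1).resolve_right hb
  · have h1 := gradAt_quadForm hNt (M *ᵥ t)
    rw [hNM] at h1
    funext i
    have h2 := congrFun h1 i
    rw [hk] at h2
    simp [gradAt] at h2
    simp only [gradAt, Pi.smul_apply, smul_eq_mul]
    field_simp
    linear_combination h2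

/-! ### From the dual conic to the focus. -/

lemma exists_rep_mk_eq_smul {v : Vec} (hv : v ≠ 0) :
    ∃ k : ℂ, k ≠ 0 ∧ (Projectivization.mk ℂ v hv).rep = k • v := by
  obtain ⟨k, hk⟩ := Projectivization.exists_smul_eq_mk_rep ℂ v hv
  exact ⟨k, k.ne_zero, by rw [← hk]; rfl⟩

lemma gradAt_smul {F : Poly} {d : ℕ} (hF : F.IsHomogeneous d) (k : ℂ) (a : Vec) :
    gradAt F (k • a) = k ^ (d - 1) • gradAt F a := by
  funext i
  simp only [gradAt, Pi.smul_apply, smul_eq_mul]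
  exact eval_smul_of_isHomogeneous hF.pderiv k a

lemma rep_isotropic {S : P2} (hSI : S ≠ cyclicI) (hSJ : S ≠ cyclicJ) (h2 : S.rep 2 = 0) :
    S.rep 0 ^ 2 + S.rep 1 ^ 2 ≠ 0 := by
  intro h
  have hI : Complex.I ^ 2 = -1 := Complex.I_sq
  have hfac : (S.rep 1 - Complex.I * S.rep 0) * (S.rep 1 + Complex.I * S.rep 0) = 0 := by
    linear_combination h - S.rep 0 ^ 2 * hI
  rcases mul_eq_zero.mp hfac with h' | h'
  · apply hSI
    rw [← Projectivization.mk_rep S, cyclicI, Projectivization.mk_eq_mk_iff']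
    refine ⟨S.rep 0, ?_⟩
    funext i
    fin_cases i
    · simp
    · simp; linear_combination -h'
    · simp [h2]
  · apply hSJ
    rw [← Projectivization.mk_rep S, cyclicJ, Projectivization.mk_eq_mk_iff']
    refine ⟨S.rep 0, ?_⟩
    funext i
    fin_cases i
    · simp
    · simp; linear_combination -h'
    · simp [h2]

/-- Whatever p and c are, an isotropic line t through S has s·t = 0 and t₀² + t₁² = 0, so it belongs
to the dual conic and is tangent to the mirror. For S at infinity the same holds of ℓ_∞. -/
lemma isFocus_of_common_point {F : Poly} {d : ℕ} (hF : F.IsHomogeneous d) (hirr : Irreducible F)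
    (hd : 2 ≤ d) {S : P2} (hSI : S ≠ cyclicI) (hSJ : S ≠ cyclicJ) {p : Vec} (hp : p ≠ 0)
    (h : F ∣ reflectedEq F S.rep p) : d = 2 ∧ IsFocus F S := by
  obtain ⟨rfl, c, κ, hκ, hdual⟩ :=
    conic_of_common_point hF hirr hd hp (rep_isotropic hSI hSJ) h
  refine ⟨rfl, ?_⟩
  -- The gradient of a quadratic form vanishes at 0, whereas at M t it is κ t.
  have hne : ∀ t : Vec, t ≠ 0 → (S.rep ⬝ᵥ t) * (p ⬝ᵥ t) = c * (t 0 ^ 2 + t 1 ^ 2) →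
      focalMatrix S.rep p c *ᵥ t ≠ 0 := by
    intro t ht0 ht hM
    have h1 := (hdual t ht).2
    have h2 := gradAt_smul hF 0 (0 : Vec)
    rw [hM] at h1
    rw [smul_zero, h1] at h2
    simp at h2
    exact h2.elim hκ ht0
  have htan : ∀ (t : Vec) (A B : P2), t ≠ 0 →
      (S.rep ⬝ᵥ t) * (p ⬝ᵥ t) = c * (t 0 ^ 2 + t 1 ^ 2) → t ⬝ᵥ A.rep = 0 → t ⬝ᵥ B.rep = 0 →
      IsTangentLineThrough F A B := by
    intro t A B ht0 ht hA hB
    obtain ⟨k, hk, hrep⟩ := exists_rep_mk_eq_smul (hne t ht0 ht)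
    have hgrad : gradAt F (Projectivization.mk ℂ _ (hne t ht0 ht)).rep = (k * κ) • t := by
      rw [hrep, gradAt_smul hF, (hdual t ht).2, smul_smul, show 2 - 1 = 1 from rfl, pow_one]
    refine ⟨Projectivization.mk ℂ _ (hne t ht0 ht), ?_, ?_, ?_, ?_⟩
    · change eval _ F = 0
      rw [hrep, eval_smul_of_isHomogeneous hF, (hdual t ht).1, mul_zero]
    · rw [IsNonsingularAt, hgrad]
      exact smul_ne_zero (mul_ne_zero hk hκ) ht0
    · change _ ⬝ᵥ _ = _
      rw [hgrad, smul_dotProduct, hA, smul_zero]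
    · change _ ⬝ᵥ _ = _
      rw [hgrad, smul_dotProduct, hB, smul_zero]
  have hI : Complex.I ^ 2 = -1 := Complex.I_sq
  by_cases h2 : S.rep 2 = 0
  · right
    have ht : (S.rep ⬝ᵥ ![0, 0, 1]) * (p ⬝ᵥ ![0, 0, 1])
        = c * ((![0, 0, 1] : Vec) 0 ^ 2 + (![0, 0, 1] : Vec) 1 ^ 2) := by
      simp [dotProduct, Fin.sum_univ_three, h2]
    have ht0 : (![0, 0, 1] : Vec) ≠ 0 := fun h0 => one_ne_zero (congrFun h0 2)
    -- The contact point of ℓ_∞ is its pole, here S itself.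
    have hM : focalMatrix S.rep p c *ᵥ ![0, 0, 1] = p 2 • S.rep := by
      funext i
      rw [focalMatrix_mulVec]
      fin_cases i <;> simp [dotProduct, Fin.sum_univ_three, h2, mul_comm]
    have hp2 : p 2 ≠ 0 := by
      intro h0
      apply hne _ ht0 ht
      rw [hM, h0, zero_smul]
    obtain ⟨h3, h4⟩ := hdual _ ht
    rw [hM, eval_smul_of_isHomogeneous hF] at h3
    rw [hM, gradAt_smul hF, show 2 - 1 = 1 from rfl, pow_one] at h4
    have hgrad : gradAt F S.rep = ((p 2)⁻¹ * κ) • ![0, 0, 1] := by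
      rw [← smul_smul, ← h4, smul_smul, inv_mul_cancel₀ hp2, one_smul]
    have hk := mul_ne_zero (inv_ne_zero hp2) hκ
    refine ⟨(mul_eq_zero.mp h3).resolve_left (pow_ne_zero _ hp2), ?_, ?_⟩
    · rw [IsNonsingularAt, hgrad]
      exact smul_ne_zero hk ht0
    · ext P
      change gradAt F S.rep ⬝ᵥ P.rep = 0 ↔ eval P.rep (X 2) = 0
      rw [hgrad, smul_dotProduct, smul_eq_mul, mul_eq_zero_iff_left hk]
      simp [dotProduct, Fin.sum_univ_three]
  · left
    refine ⟨fun h0 => h2 (by simpa using (show eval S.rep (X 2 : Poly) = 0 from h0)), ?_, ?_⟩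
    · obtain ⟨k, -, hrep⟩ := exists_rep_mk_eq_smul (v := ![1, Complex.I, 0])
        (fun h => one_ne_zero (congrFun h 0))
      -- The cross product I × S, that is, the line (IS).
      refine htan ![Complex.I * S.rep 2, -S.rep 2, S.rep 1 - Complex.I * S.rep 0] _ _
        (fun h0 => h2 (by simpa using congrFun h0 1)) ?_ ?_ ?_
      · simp [dotProduct, Fin.sum_univ_three, mul_pow]
        left
        ring
      · rw [cyclicI, hrep]
        simp [dotProduct, Fin.sum_univ_three]
        ring
      · simp [dotProduct, Fin.sum_univ_three]
        ring
    · obtain ⟨k, -, hrep⟩ := exists_rep_mk_eq_smul (v := ![1, -Complex.I, 0])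
        (fun h => one_ne_zero (congrFun h 0))
      refine htan ![-Complex.I * S.rep 2, -S.rep 2, S.rep 1 + Complex.I * S.rep 0] _ _
        (fun h0 => h2 (by simpa using congrFun h0 1)) ?_ ?_ ?_
      · simp [dotProduct, Fin.sum_univ_three, mul_pow]
        left
        ring
      · rw [cyclicJ, hrep]
        simp [dotProduct, Fin.sum_univ_three]
        ring
      · simp [dotProduct, Fin.sum_univ_three]
        ring

/-! ### The caustic map and its nonconstancy. -/

lemma reflectedMap_isHomogeneous {F : Poly} {d : ℕ} (hF : F.IsHomogeneous d) (s : Vec)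
    (i : Fin 3) : (reflectedMap F s i).IsHomogeneous (1 + ((d - 1) + (d - 1))) := by
  have hQ := gradSq_isHomogeneous hF
  have hσ := polar_isHomogeneous hF s
  have hX := fun j => isHomogeneous_X ℂ (σ := Fin 3) j
  have hlin : ∀ (j k : Fin 3) (a b : ℂ), (C a * X j - X k * C b : Poly).IsHomogeneous 1 := by
    intro j k a b
    rw [mul_comm (X k)]
    exact ((hX j).C_mul a).sub ((hX k).C_mul b)
  have htwo : ∀ j : Fin 3, (2 * X j : Poly).IsHomogeneous 1 := fun j => (hX j).C_mul 2
  have htwo' : (2 * polar s F : Poly).IsHomogeneous (d - 1) := hσ.C_mul 2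
  fin_cases i
  · refine ((hlin 1 2 _ _).mul hQ).add ?_
    rw [← add_assoc]
    exact ((htwo 2).mul hσ).mul hF.pderiv
  · refine IsHomogeneous.sub ?_ ?_
    · rw [← neg_sub, neg_mul]
      exact ((hlin 0 2 _ _).mul hQ).neg
    · rw [← add_assoc]
      exact ((htwo 2).mul hσ).mul hF.pderiv
  · refine IsHomogeneous.sub ?_ ?_
    · rw [mul_comm (X 0)]
      exact (hlin 0 1 _ _).mul hQ
    · rw [add_left_comm]
      exact htwo'.mul (((hX 0).mul hF.pderiv).sub ((hX 1).mul hF.pderiv))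

lemma tangentDeriv_isHomogeneous {F p : Poly} {d e : ℕ} (hF : F.IsHomogeneous d)
    (hp : p.IsHomogeneous e) : (tangentDeriv F p).IsHomogeneous ((d - 1) + (e - 1)) := by
  rw [tangentDeriv_apply]
  exact (hF.pderiv.mul hp.pderiv).sub (hF.pderiv.mul hp.pderiv)

/-- The caustic map: the cross product of the reflected map and of its derivative along the
mirror. -/
def causticMap (F : Poly) (s : Vec) : Fin 3 → Poly :=
  reflectedMap F s ⨯₃ fun i => tangentDeriv F (reflectedMap F s i)

/-- The degree of the forms `causticMap F s i`, when `F` has degree `d`. -/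
def causticDegree (d : ℕ) : ℕ := (1 + ((d - 1) + (d - 1))) + ((d - 1) + ((d - 1) + (d - 1)))

lemma causticMap_isHomogeneous {F : Poly} {d : ℕ} (hF : F.IsHomogeneous d) (s : Vec)
    (i : Fin 3) : (causticMap F s i).IsHomogeneous (causticDegree d) := by
  have hR := reflectedMap_isHomogeneous hF s
  have hD : ∀ j, (tangentDeriv F (reflectedMap F s j)).IsHomogeneous
      ((d - 1) + ((d - 1) + (d - 1))) := by
    intro j
    simpa using tangentDeriv_isHomogeneous hF (hR j)
  rw [causticMap, cross_apply]
  fin_cases i <;> exact ((hR _).mul (hD _)).sub ((hR _).mul (hD _))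

/-- If R ≡ 0, every p is a common point. The first integrals for p = (1,0,0) and (0,1,0), with
constants c and b, combine to F ∣ (s·∇F)(b F_x − c F_y), so c = 0, and then F ∣ (s·∇F) F_x, which is
impossible. -/
lemma exists_not_dvd_reflectedMap {F : Poly} {d : ℕ} (hF : F.IsHomogeneous d)
    (hirr : Irreducible F) (hd : 2 ≤ d) {s : Vec} (hs : s ≠ 0) :
    ∃ i, ¬ F ∣ reflectedMap F s i := by
  by_contra hcon
  push Not at hcon
  have hσ : ¬ F ∣ polar s F := fun h => hs (dvd_polar_imp_eq_zero hF hirr hd h)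
  have hall : ∀ p, F ∣ reflectedEq F s p := fun p =>
    Finset.dvd_sum fun i _ => (hcon i).mul_left _
  obtain ⟨c, hc⟩ := exists_first_integral hF hirr hd (hall (Pi.single 0 1))
  obtain ⟨b, hb⟩ := exists_first_integral hF hirr hd (hall (Pi.single 1 1))
  have h1 : F ∣ polar s F * polar ![b, -c, 0] F := by
    have := dvd_sub (hc.mul_left (C b)) (hb.mul_left (C c))
    convert this using 1
    simp [polar]
    ring
  have h2 := dvd_polar_imp_eq_zero hF hirr hd ((hirr.prime.dvd_or_dvd h1).resolve_left hσ)
  have hc0 : c = 0 := by simpa using congrFun h2 1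
  rw [hc0, map_zero, zero_mul, sub_zero] at hc
  simpa using congrFun
    (dvd_polar_imp_eq_zero hF hirr hd ((hirr.prime.dvd_or_dvd hc).resolve_left hσ)) 0

lemma reflectedMap_dot_X (F : Poly) (s : Vec) : ∑ i, reflectedMap F s i * X i = 0 := by
  simp [Fin.sum_univ_three, reflectedMap]
  ring

lemma reflectedMap_dot_causticMap (F : Poly) (s : Vec) :
    ∑ i, reflectedMap F s i * causticMap F s i = 0 := by
  simp [Fin.sum_univ_three, causticMap, cross_apply]
  ring

lemma dvd_of_dvd_crossProduct {F : Poly} {R T : Fin 3 → Poly} (h : ∀ i, F ∣ (R ⨯₃ T) i)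
    (i k : Fin 3) : F ∣ R k * T i - R i * T k := by
  have h0 := h 0
  have h1 := h 1
  have h2 := h 2
  rw [cross_apply] at h0 h1 h2
  simp only [cons_val_zero, cons_val_one, cons_val] at h0 h1 h2
  have h0' := (dvd_neg.mpr h0)
  have h1' := (dvd_neg.mpr h1)
  have h2' := (dvd_neg.mpr h2)
  rw [neg_sub] at h0' h1' h2'
  fin_cases i <;> fin_cases k
  · simp
  · exact h2'
  · exact h1
  · exact h2
  · simp
  · exact h0'
  · exact h1'
  · exact h0
  · simp

/-- If R × DR ≡ 0, then R has a constant direction c; as each reflected line contains its m, the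
mirror would lie on the line c. -/
lemma exists_not_dvd_causticMap {F : Poly} {d : ℕ} (hF : F.IsHomogeneous d)
    (hirr : Irreducible F) (hd : 2 ≤ d) {s : Vec} (hs : s ≠ 0) :
    ∃ i, ¬ F ∣ causticMap F s i := by
  by_contra hcon
  push Not at hcon
  obtain ⟨j, hj⟩ := exists_not_dvd_reflectedMap hF hirr hd hs
  have hR := reflectedMap_isHomogeneous hF s
  have hdot := reflectedMap_dot_X F s
  have hcross := dvd_of_dvd_crossProduct hcon
  generalize reflectedMap F s = R at *
  have hex : ∀ i, ∃ c : ℂ, F ∣ R i - C c * R j := fun i =>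
    exists_dvd_sub_of_tangentDeriv hF hirr.prime (not_dvd_X hF hd 2)
      (fun h' => not_dvd_pderiv hF hirr hd 0 h'.1) (by omega) (hR i) (hR j) hj (hcross i j)
  choose c hc using hex
  have h1 : F ∣ R j * linForm c := by
    have h2 := Finset.dvd_sum (s := Finset.univ) fun i _ => (hc i).mul_right (X i)
    rw [← dvd_neg]
    convert h2 using 1
    simp only [linForm, Fin.sum_univ_three] at hdot ⊢
    linear_combination -hdot
  have h3 : c = 0 := by
    by_contra h0
    exact not_dvd_linForm hF hd h0 ((hirr.prime.dvd_or_dvd h1).resolve_left hj)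
  have := hc j
  simp [h3] at this
  exact hj this

/-- Without an independent pair the map has a constant value c, and R · (R × DR) = 0 puts c on every
reflected line. -/
lemma exists_indepMod_causticMap {F : Poly} {d : ℕ} (hF : F.IsHomogeneous d)
    (hirr : Irreducible F) (hd : 2 ≤ d) {s : Vec} (hs : s ≠ 0)
    (hcp : ∀ p : Vec, p ≠ 0 → ¬ F ∣ reflectedEq F s p) :
    ∃ i j, IndepMod F (causticMap F s i) (causticMap F s j) := by
  by_contra hcon
  push Not at hcon
  obtain ⟨j, hj⟩ := exists_not_dvd_causticMap hF hirr hd hs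
  have hN := causticMap_isHomogeneous hF s
  have hdot := reflectedMap_dot_causticMap F s
  generalize causticMap F s = N at *
  have hex : ∀ i, ∃ c : ℂ, F ∣ N i - C c * N j := fun i =>
    exists_dvd_sub_of_not_indepMod hF hirr.prime (by unfold causticDegree; omega) (hN i) (hN j) hj
      (hcon i j)
  choose c hc using hex
  have h1 : F ∣ N j * reflectedEq F s c := by
    have h2 := Finset.dvd_sum (s := Finset.univ) fun i _ => (hc i).mul_left (reflectedMap F s i)
    rw [← dvd_neg]
    convert h2 using 1
    simp only [reflectedEq, Fin.sum_univ_three] at hdot ⊢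
    linear_combination -hdot
  refine hcp c ?_ ((hirr.prime.dvd_or_dvd h1).resolve_left hj)
  intro h0
  have := hc j
  simp [h0] at this
  exact hj this

/-! ### The envelope as the image of the caustic map. -/

/-- The Nullstellensatz for the prime ideal (F). -/
lemma dvd_of_forall_eval {F B : Poly} (hF : Prime F)
    (h : ∀ a : Vec, eval a F = 0 → eval a B = 0) : F ∣ B := by
  have hP : (Ideal.span {F}).IsPrime := (Ideal.span_singleton_prime hF.ne_zero).mpr hF
  rw [← Ideal.mem_span_singleton,
    ← MvPolynomial.IsPrime.vanishingIdeal_zeroLocus (K := ℂ) (Ideal.span {F}),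
    mem_vanishingIdeal_iff]
  intro a ha
  rw [mem_zeroLocus_iff] at ha
  have := ha F (Ideal.mem_span_singleton_self F)
  rw [aeval_eq_eval] at this ⊢
  exact h a this

lemma exists_ne_dotProduct_eq_zero (L : Vec) (P : P2) : ∃ Q : P2, Q ≠ P ∧ L ⬝ᵥ Q.rep = 0 := by
  have hlt : (Submodule.span ℂ {P.rep}) < ⊤ := by
    refine lt_top_iff_ne_top.mpr fun h => ?_
    have h1 := finrank_span_singleton (K := ℂ) P.rep_nonzero
    rw [h, finrank_top] at h1
    simp at h1
  have hker : ¬ LinearMap.ker (dotProductBilin ℂ ℂ L) ≤ Submodule.span ℂ {P.rep} := by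
    intro hle
    have h1 := Submodule.finrank_mono hle
    rw [finrank_span_singleton (K := ℂ) P.rep_nonzero] at h1
    have h2 := LinearMap.finrank_range_add_finrank_ker (dotProductBilin ℂ ℂ L)
    have h3 := Submodule.finrank_le (LinearMap.range (dotProductBilin ℂ ℂ L))
    simp at h2 h3
    omega
  obtain ⟨v, hv, hvP⟩ := SetLike.not_le_iff_exists.mp hker
  have hv0 : v ≠ 0 := by
    rintro rfl
    exact hvP (zero_mem _)
  obtain ⟨k, hk, hrep⟩ := exists_rep_mk_eq_smul hv0
  refine ⟨Projectivization.mk ℂ v hv0, ?_, ?_⟩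
  · rintro rfl
    apply hvP
    rw [hrep, Submodule.mem_span_singleton]
    exact ⟨k⁻¹, by rw [smul_smul, inv_mul_cancel₀ hk, one_smul]⟩
  · rw [hrep, dotProduct_smul, show L ⬝ᵥ v = 0 from hv, smul_zero]

/-- Where R × DR vanishes, the two characteristic equations hold on a whole line, so no
characteristic point is unique. -/
lemma exists_common_normal {R T : Vec} (h : R ⨯₃ T = 0) :
    ∃ L : Vec, ∀ v, L ⬝ᵥ v = 0 → R ⬝ᵥ v = 0 ∧ T ⬝ᵥ v = 0 := by
  by_cases hR : R = 0
  · exact ⟨T, fun v hv => ⟨by simp [hR], hv⟩⟩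
  · obtain ⟨i, hi⟩ := Function.ne_iff.mp hR
    have hi' : R i ≠ 0 := hi
    have hT : T = (T i / R i) • R := by
      have e := fun j => congrFun h j
      have e0 := e 0
      have e1 := e 1
      have e2 := e 2
      simp [cross_apply] at e0 e1 e2
      funext j
      simp only [Pi.smul_apply, smul_eq_mul]
      field_simp
      fin_cases i <;> fin_cases j <;> simp <;> first
        | linear_combination e0
        | linear_combination -e0
        | linear_combination e1
        | linear_combination -e1
        | linear_combination e2
        | linear_combination -e2
    exact ⟨R, fun v hv => ⟨hv, by rw [hT, smul_dotProduct, hv, smul_zero]⟩⟩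

lemma eq_smul_cross {R T v : Vec} (h : R ⨯₃ T ≠ 0) (hR : R ⬝ᵥ v = 0) (hT : T ⬝ᵥ v = 0) :
    ∃ k : ℂ, k • (R ⨯₃ T) = v := by
  obtain ⟨i, hi⟩ := Function.ne_iff.mp h
  have hi' : (R ⨯₃ T) i ≠ 0 := hi
  refine ⟨v i / (R ⨯₃ T) i, ?_⟩
  funext j
  simp only [Pi.smul_apply, smul_eq_mul]
  rw [div_mul_eq_mul_div, div_eq_iff hi', cross_apply]
  simp only [dotProduct, Fin.sum_univ_three] at hR hT
  fin_cases i <;> fin_cases j <;> simp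
  · linear_combination R 2 * hT - T 2 * hR
  · linear_combination T 1 * hR - R 1 * hT
  · linear_combination T 2 * hR - R 2 * hT
  · linear_combination R 0 * hT - T 0 * hR
  · linear_combination R 1 * hT - T 1 * hR
  · linear_combination T 0 * hR - R 0 * hT

/-- The value of the caustic map at the vector `a`. -/
def causticAt (F : Poly) (s a : Vec) : Vec := fun i => eval a (causticMap F s i)

lemma causticAt_eq_cross (F : Poly) (s a : Vec) : causticAt F s a =
    reflectedAt F s a ⨯₃ reflectedDerivAt F s a ![gradAt F a 1, -gradAt F a 0, 0] := by
  funext i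
  rw [causticAt, causticMap, cross_apply, cross_apply]
  fin_cases i <;>
  simp [reflectedAt, reflectedDerivAt, tangentDeriv_apply, Fin.sum_univ_three, gradAt] <;> ring

lemma reflectedDerivAt_self {F : Poly} {d : ℕ} (hF : F.IsHomogeneous d) (s a : Vec) :
    reflectedDerivAt F s a a = ((1 + ((d - 1) + (d - 1)) : ℕ) : ℂ) • reflectedAt F s a := by
  funext i
  have h := congrArg (eval a) (reflectedMap_isHomogeneous hF s i).sum_X_mul_pderiv
  simpa [Fin.sum_univ_three, reflectedDerivAt, reflectedAt, add_assoc] using h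

lemma reflectedDerivAt_add_smul (F : Poly) (s a τ υ : Vec) (b c : ℂ) :
    reflectedDerivAt F s a (b • τ + c • υ) =
      b • reflectedDerivAt F s a τ + c • reflectedDerivAt F s a υ := by
  funext i
  simp [reflectedDerivAt, Fin.sum_univ_three]
  ring

/-- The kernel of dF(m) is spanned by m, along which the derivative of R is a multiple of R by
Euler, and by (F_y, −F_x, 0). -/
lemma isCharacteristicPoint_iff {F : Poly} {d : ℕ} (hF : F.IsHomogeneous d) {S m : P2}
    (hm : m ∈ mirrorDomain F S) (P : P2) : IsCharacteristicPoint F S m P ↔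
      reflectedAt F S.rep m.rep ⬝ᵥ P.rep = 0 ∧
      reflectedDerivAt F S.rep m.rep ![gradAt F m.rep 1, -gradAt F m.rep 0, 0] ⬝ᵥ P.rep = 0 := by
  obtain ⟨hmF, hm'⟩ := hm
  have hE := euler_relation hF (show eval m.rep F = 0 from hmF)
  have hz : m.rep 2 ≠ 0 := fun h =>
    hm' (Or.inl (Or.inr (show eval m.rep (X 2 : Poly) = 0 by simpa using h)))
  have hQ : gradAt F m.rep 0 ^ 2 + gradAt F m.rep 1 ^ 2 ≠ 0 := fun h =>
    hm' (Or.inr (show eval m.rep (gradSq F) = 0 by simpa [gradSq, gradAt] using h))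
  refine and_congr_right fun hR => ⟨fun h => h _ ?_, fun h τ hτ => ?_⟩
  · simp [dotProduct, Fin.sum_univ_three]
    ring
  · have hdec : τ = (τ 2 / m.rep 2) • m.rep +
        (((τ 0 - τ 2 / m.rep 2 * m.rep 0) * gradAt F m.rep 1
          - (τ 1 - τ 2 / m.rep 2 * m.rep 1) * gradAt F m.rep 0) /
          (gradAt F m.rep 0 ^ 2 + gradAt F m.rep 1 ^ 2)) •
        ![gradAt F m.rep 1, -gradAt F m.rep 0, 0] := by
      simp only [dotProduct, Fin.sum_univ_three] at hτ
      generalize gradAt F m.rep 0 = f0 at *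
      generalize gradAt F m.rep 1 = f1 at *
      generalize gradAt F m.rep 2 = f2 at *
      funext i
      fin_cases i
      · simp
        field_simp
        linear_combination f0 * m.rep 2 * hτ - f0 * τ 2 * hE
      · simp
        field_simp
        linear_combination f1 * m.rep 2 * hτ - f1 * τ 2 * hE
      · simp
        field_simp
    rw [hdec, reflectedDerivAt_add_smul, reflectedDerivAt_self hF, add_dotProduct, smul_dotProduct,
      smul_dotProduct, smul_dotProduct, hR, h]
    simp

lemma isCharacteristicPoint_iff_eq {F : Poly} {d : ℕ} (hF : F.IsHomogeneous d) {S m : P2}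
    (hm : m ∈ mirrorDomain F S) (h : causticAt F S.rep m.rep ≠ 0) (P : P2) :
    IsCharacteristicPoint F S m P ↔ P = Projectivization.mk ℂ _ h := by
  rw [isCharacteristicPoint_iff hF hm]
  constructor
  · rintro ⟨h1, h2⟩
    rw [causticAt_eq_cross] at h
    obtain ⟨k, hk⟩ := eq_smul_cross h h1 h2
    rw [← Projectivization.mk_rep P, Projectivization.mk_eq_mk_iff', causticAt_eq_cross]
    exact ⟨k, hk⟩
  · rintro rfl
    obtain ⟨k, -, hrep⟩ := exists_rep_mk_eq_smul h
    rw [hrep, causticAt_eq_cross, dotProduct_smul, dotProduct_smul, dot_self_cross,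
      dot_cross_self, smul_zero]
    exact ⟨rfl, rfl⟩

lemma mem_reflectedEnvelope_iff {F : Poly} {d : ℕ} (hF : F.IsHomogeneous d) {S P : P2} :
    P ∈ reflectedEnvelope F S ↔ ∃ m ∈ mirrorDomain F S, ∃ h : causticAt F S.rep m.rep ≠ 0,
      P = Projectivization.mk ℂ _ h := by
  refine exists_congr fun m => and_congr_right fun hm => ⟨fun hP => ?_, ?_⟩
  · by_cases h : causticAt F S.rep m.rep = 0
    · exfalso
      rw [causticAt_eq_cross] at h
      obtain ⟨L, hL⟩ := exists_common_normal h
      obtain ⟨Q, hQP, hQ⟩ := exists_ne_dotProduct_eq_zero L P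
      exact hQP ((hP Q).mp ((isCharacteristicPoint_iff hF hm Q).mpr (hL _ hQ)))
    · exact ⟨h, (isCharacteristicPoint_iff_eq hF hm h P).mp ((hP P).mpr rfl)⟩
  · rintro ⟨h, rfl⟩ P'
    exact isCharacteristicPoint_iff_eq hF hm h P'

lemma eval_aeval_causticMap (F H : Poly) (s a : Vec) :
    eval a (aeval (causticMap F s) H) = eval (causticAt F s a) H := by
  rw [← aeval_eq_eval, ← aeval_eq_eval]
  rw [← AlgHom.comp_apply]
  congr 1
  ext i
  simp [causticAt, aeval_eq_eval]

lemma reflectedEnvelope_subset_iff {F : Poly} {d : ℕ} (hF : F.IsHomogeneous d)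
    (hirr : Irreducible F) (hd : 2 ≤ d) {S : P2} {H : Poly} {n : ℕ} (hH : H.IsHomogeneous n) :
    reflectedEnvelope F S ⊆ zeroLocus H ↔ F ∣ aeval (causticMap F S.rep) H := by
  constructor
  · intro hsub
    obtain ⟨j, hj⟩ := exists_not_dvd_causticMap hF hirr hd S.rep_nonzero
    obtain ⟨V, -, hV⟩ := exists_ne_dotProduct_eq_zero S.rep S
    by_contra hcon
    have hN := causticMap_isHomogeneous hF S.rep
    -- The factors of B after the first exclude a zero caustic vector and the points outside
    -- `mirrorDomain`; `linForm V.rep` is a line through S and so excludes m = S.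
    let B : Poly := aeval (causticMap F S.rep) H * causticMap F S.rep j * X 2 * gradSq F *
      linForm V.rep
    have hBhom := ((((hH.aeval _ hN).mul (hN j)).mul (isHomogeneous_X ℂ 2)).mul
      (gradSq_isHomogeneous hF)).mul (linForm_isHomogeneous V.rep)
    have hB : ¬ F ∣ B := by
      intro h
      rcases hirr.prime.dvd_or_dvd h with h | h
      · rcases hirr.prime.dvd_or_dvd h with h | h
        · rcases hirr.prime.dvd_or_dvd h with h | h
          · rcases hirr.prime.dvd_or_dvd h with h | h
            · exact hcon h
            · exact hj h
          · exact not_dvd_X hF hd 2 h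
        · exact not_dvd_gradSq hF hirr hd h
      · exact not_dvd_linForm hF hd V.rep_nonzero h
    obtain ⟨a, haF, haB⟩ : ∃ a : Vec, eval a F = 0 ∧ eval a B ≠ 0 := by
      by_contra! h
      exact hB (dvd_of_forall_eval hirr.prime h)
    have ha0 : a ≠ 0 := by
      rintro rfl
      apply haB
      simp [B]
    obtain ⟨k, hk, hrep⟩ := exists_rep_mk_eq_smul ha0
    generalize Projectivization.mk ℂ a ha0 = m at hrep
    have hmF : eval m.rep F = 0 := by
      rw [hrep, eval_smul_of_isHomogeneous hF, haF, mul_zero]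
    have hmB : eval m.rep B ≠ 0 := by
      rw [hrep, eval_smul_of_isHomogeneous hBhom]
      exact mul_ne_zero (pow_ne_zero _ hk) haB
    simp only [B, map_mul, mul_ne_zero_iff] at hmB
    obtain ⟨⟨⟨⟨h1, h2⟩, h3⟩, h4⟩, h5⟩ := hmB
    have hm : m ∈ mirrorDomain F S := by
      refine ⟨hmF, ?_⟩
      rintro ((h | h) | h)
      · rw [show m = S from h, eval_linForm, dotProduct_comm] at h5
        exact h5 hV
      · exact h3 h
      · exact h4 h
    have hc : causticAt F S.rep m.rep ≠ 0 := fun h => h2 (congrFun h j)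
    obtain ⟨l, hl, hlrep⟩ := exists_rep_mk_eq_smul hc
    have hP := hsub ((mem_reflectedEnvelope_iff hF).mpr ⟨m, hm, hc, rfl⟩)
    change eval (Projectivization.mk ℂ _ hc).rep H = 0 at hP
    rw [hlrep, eval_smul_of_isHomogeneous hH, ← eval_aeval_causticMap] at hP
    exact mul_ne_zero (pow_ne_zero _ hl) h1 hP
  · rintro ⟨K, hK⟩ P hP
    obtain ⟨m, hm, hc, rfl⟩ := (mem_reflectedEnvelope_iff hF).mp hP
    obtain ⟨l, -, hlrep⟩ := exists_rep_mk_eq_smul hc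
    change eval (Projectivization.mk ℂ _ hc).rep H = 0
    rw [hlrep, eval_smul_of_isHomogeneous hH, ← eval_aeval_causticMap, hK, map_mul,
      show eval m.rep F = 0 from hm.1, zero_mul, mul_zero]

lemma IndepMod.linear {F p q : Poly} (h : IndepMod F p q) {a b : ℂ}
    (hab : F ∣ C a * p + C b * q) : a = 0 ∧ b = 0 := by
  have h0 := h (C a * X 0 + C b * X 1) (by simpa using hab)
  constructor
  · simpa using congrArg (eval ![1, 0]) h0
  · simpa using congrArg (eval ![0, 1]) h0

end CausticByReflection

end

/-! ### The proposition. -/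

open CausticByReflection in
theorem mainTheorem7 (d : ℕ) (F : MvPolynomial (Fin 3) ℂ) (hF : F.IsHomogeneous d)
    (hirr : Irreducible F) (S : ℙ ℂ (Fin 3 → ℂ))
    (hSI : S ≠ cyclicI) (hSJ : S ≠ cyclicJ) (hd : d ≠ 1)
    (hfocus : d = 2 → ¬ IsFocus F S) :
    (¬ ∃ P, caustic F S = {P}) ∧ IsIrreducibleCurve (caustic F S) := by
  have hd2 := two_le_degree hF hirr hd
  obtain ⟨i, j, hij⟩ := exists_indepMod_causticMap hF hirr hd2 S.rep_nonzero (fun p hp h => by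
    obtain ⟨h2, hfoc⟩ := isFocus_of_common_point hF hirr hd2 hSI hSJ hp h
    exact hfocus h2 hfoc)
  constructor
  · rintro ⟨P, hP⟩
    have hlin : ∀ v : Vec, v ⬝ᵥ P.rep = 0 →
        F ∣ ∑ l, MvPolynomial.C (v l) * causticMap F S.rep l := by
      intro v hv
      have h1 : reflectedEnvelope F S ⊆ CausticByReflection.zeroLocus (linForm v) := by
        intro Q hQ
        have hQ' : Q ∈ caustic F S := fun G n _ hG => hG hQ
        rw [hP] at hQ'
        rw [show Q = P from hQ']
        exact (eval_linForm v P.rep).trans hv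
      have h2 := (reflectedEnvelope_subset_iff hF hirr hd2 (linForm_isHomogeneous v)).mp h1
      simpa [linForm] using h2
    -- This line through P gives P_j N_i − P_i N_j ≡ 0, so P_i = P_j = 0 by independence. Then the
    -- i-th coordinate line contains P too, and N_i ≡ 0 contradicts independence.
    have h1 := hlin (P.rep j • Pi.single i 1 - P.rep i • Pi.single j 1) (by
      simp [sub_dotProduct, mul_comm])
    have h2 := hij.linear (a := P.rep j) (b := -P.rep i) (by
      convert h1 using 1
      simp [add_mul, Finset.sum_add_distrib, Pi.single_apply, apply_ite MvPolynomial.C,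
        sub_eq_add_neg])
    have h3 := hlin (Pi.single i 1) (by simpa using h2.2)
    have h4 := hij.linear (a := 1) (b := 0) (by
      convert h3 using 1
      simp [Pi.single_apply, apply_ite MvPolynomial.C])
    exact one_ne_zero h4.1
  · obtain ⟨G, n, hG, hGirr, hiff⟩ := exists_implicit_equation hF hirr.prime
      (by unfold causticDegree; omega) (causticMap_isHomogeneous hF S.rep) hij
    refine ⟨G, n, hG, hGirr, ?_⟩
    ext P
    constructor
    · intro hP
      exact hP G n hG ((reflectedEnvelope_subset_iff hF hirr hd2 hG).mpr ((hiff G).mpr dvd_rfl))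
    · intro hP H k hH hsub
      obtain ⟨K, rfl⟩ := (hiff H).mp ((reflectedEnvelope_subset_iff hF hirr hd2 hH).mp hsub)
      change MvPolynomial.eval P.rep (G * K) = 0
      rw [map_mul, show MvPolynomial.eval P.rep G = 0 from hP, zero_mul]
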